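/- Let $a<b$, $r\ge 1$, and let $\xi_1,\dots,\xi_{r+1}\in[0,1]$ be pairwise distinct points with $\xi_1=0$, $\xi_{r+1}=1$. Let $\hat\omega_1,\dots,\hat\omega_{r+1}$ be the basis of the polynomials of degree at most $r$ with $\hat\omega_i(\xi_j)=\delta_{ij}$. For $n\ge1$ put $h=(b-a)/n$ and consider the uniform mesh of $[a,b]$ with elements $I_k=[a+kh,a+(k+1)h]$, $0\le k<n$. The $i$-th node of $I_k$, $a+(k+\xi_i)h$, has the global index $kr+i-1\in\{0,\dots,nr\}$. For $1\le m\le nr-1$ let $\varphi_m$ be the continuous function on $[a,b]$ which on every $I_k$ equals $\hat\omega_i((x-a)/h-k)$ if $m=kr+i-1$ for some $1\le i\le r+1$, and $0$ otherwise. These functions are a basis of the continuous piecewise polynomial functions of degree at most $r$ vanishing at $a$ and $b$. The stiffness matrix of $-u''=f$, $u(a)=u(b)=0$ (that is, $b(x)\equiv 1$), in the normalization in which each element contributes an integral over the reference element without Jacobian factor, is $$A_n=\Big[h\int_a^b\varphi_p'(x)\varphi_q'(x)\,dx\Big]_{p,q=1}^{nr-1}.$$ Let $A^{\rm loc}_{ij}=\int_0^1\hat\omega_i'\hat\omega_j'\,dx$,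 $1\le i,j\le r+1$, and let $A_\xi$ be the matrix obtained from $A^{\rm loc}$ by replacing both the $(1,1)$ and the $(r+1,r+1)$ entry by $A^{\rm loc}_{11}+A^{\rm loc}_{r+1,r+1}$. Let $\alpha_\xi\in\mathbb R^{r\times r}$ be the leading $r\times r$ block of $A_\xi$, and let $\beta_\xi\in\mathbb R^{r\times r}$ have as first row the first $r$ entries of the last row of $A_\xi$, all other rows being zero. Define $$f_r^\xi:[-\pi,\pi]\to\mathbb C^{r\times r},\qquad f_r^\xi(\theta)=\alpha_\xi+\beta_\xi e^{\mathrm i\theta}+\beta_\xi^Te^{-\mathrm i\theta},$$ which is Hermitian-valued, with eigenvalues $\lambda_1(f_r^\xi(\theta))\le\dots\le\lambda_r(f_r^\xi(\theta))$. For $f:[-\pi,\pi]\to\mathbb C^{r\times r}$ let $T_n(f)=[\hat f_{i-j}]_{i,j=1}^n\in\mathbb C^{nr\times nr}$, $\hat f_k=\frac1{2\pi}\int_{-\pi}^{\pi}f(\theta)e^{-\mathrm ik\theta}\,d\theta$. For a sequence of square matrices $X_n$ of size $d_n\to\infty$, write $\{X_n\}\sim_\lambda f$ (eigenvalue distribution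 $f$) if for every continuous compactly supported $F:\mathbb C\to\mathbb C$ $$\lim_{n\to\infty}\frac1{d_n}\sum_{i=1}^{d_n}F(\lambda_i(X_n))=\frac1{2\pi}\int_{-\pi}^{\pi}\frac1r\sum_{i=1}^rF(\lambda_i(f(\theta)))\,d\theta,$$ and $\{X_n\}\sim_\sigma f$ (singular value distribution $f$) if the same holds with singular values $\sigma_i$ in place of eigenvalues, for every continuous compactly supported $F:\mathbb R\to\mathbb C$. The sequence is weakly clustered at a nonempty closed set $S\subseteq\mathbb C$ if for every $\epsilon>0$ the number of eigenvalues of $X_n$ (with multiplicity) outside $\bigcup_{z\in S}\{w:|w-z|<\epsilon\}$ is $o(d_n)$. Then: 1. For every $n\ge1$, $A_n$ is a principal submatrix of size $nr-1$ of $T_n(f_r^\xi)$; precisely, it is obtained from $T_n(f_r^\xi)$ by deleting the first row and the first column. 2. $\{T_n(f_r^\xi)\}\sim_\sigma f_r^\xi$ and $\{T_n(f_r^\xi)\}\sim_\lambda f_r^\xi$. 3. $\{A_n\}\sim_\sigma f_r^\xi$ and $\{A_n\}\sim_\lambda f_r^\xi$. 4. The set $\bigcup_{j=1}^r\{\lambda_j(f_r^\xi(\theta)):\theta\in[-\pi,\pi]\}$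 is nonempty and closed, and both $\{T_n(f_r^\xi)\}$ and $\{A_n\}$ are weakly clustered at it. -/

import Mathlib

open scoped Matrix Topology
open MeasureTheory (MeasureSpace volume NullMeasurableSet)

noncomputable section

namespace WeightsFEM

section SpectralNotions

variable {ι : ℕ → Type} [∀ n, Fintype (ι n)] [∀ n, DecidableEq (ι n)]
variable {X : Type} [MeasureSpace X] {r : ℕ}

/-- The multiset of the eigenvalues of a complex square matrix, with algebraic multiplicity. -/
def eigs {m : Type} [Fintype m] [DecidableEq m] (A : Matrix m m ℂ) : Multiset ℂ :=
  A.charpoly.roots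

/-- The `k`-th singular value (zero-based, nonincreasing order) of a complex square matrix; the
singular values of an `m × m` matrix are those with `k < card m`. -/
def sv {m : Type} [Fintype m] [DecidableEq m] (A : Matrix m m ℂ) (k : ℕ) : ℝ :=
  (Matrix.toEuclideanLin A).singularValues k

/-- What is presupposed of a symbol `f : D → ℂ^{r × r}`, `r ≥ 1`: the components are measurable
on `D` (up to null sets), and `0 < μ(D) < ∞`. -/
def IsSymbol (D : Set X) (f : X → Matrix (Fin r) (Fin r) ℂ) : Prop :=
  1 ≤ r ∧ NullMeasurableSet D volume ∧ 0 < volume D ∧ volume D < ⊤ ∧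
    ∀ i j, AEMeasurable (fun x => f x i j) (volume.restrict D)

/-- `{A_n} ∼_σ f`: the singular values of `A_n` (of size `d_n = card (ι n) → ∞`) are distributed
as the symbol `f` on `D`, in the sense of Weyl. -/
def SingularValueDistribution (A : ∀ n, Matrix (ι n) (ι n) ℂ)
    (D : Set X) (f : X → Matrix (Fin r) (Fin r) ℂ) : Prop :=
  IsSymbol D f ∧
  Filter.Tendsto (fun n => Fintype.card (ι n)) Filter.atTop Filter.atTop ∧
  ∀ F : ℝ → ℂ, Continuous F → HasCompactSupport F →
    Filter.Tendsto
      (fun n => (1 / (Fintype.card (ι n) : ℂ)) *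
        ∑ k ∈ Finset.range (Fintype.card (ι n)), F (sv (A n) k))
      Filter.atTop
      (𝓝 ((1 / ((volume.real D : ℝ) : ℂ)) *
        ∫ x in D, (∑ k ∈ Finset.range r, F (sv (f x) k)) / (r : ℂ)))

/-- `{A_n} ∼_λ f`: the eigenvalues of `A_n` (of size `d_n = card (ι n) → ∞`) are distributed
as the symbol `f` on `D`, in the sense of Weyl. -/
def EigenvalueDistribution (A : ∀ n, Matrix (ι n) (ι n) ℂ)
    (D : Set X) (f : X → Matrix (Fin r) (Fin r) ℂ) : Prop :=
  IsSymbol D f ∧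
  Filter.Tendsto (fun n => Fintype.card (ι n)) Filter.atTop Filter.atTop ∧
  ∀ F : ℂ → ℂ, Continuous F → HasCompactSupport F →
    Filter.Tendsto
      (fun n => (1 / (Fintype.card (ι n) : ℂ)) * ((eigs (A n)).map F).sum)
      Filter.atTop
      (𝓝 ((1 / ((volume.real D : ℝ) : ℂ)) *
        ∫ x in D, ((eigs (f x)).map F).sum / (r : ℂ)))

open Classical in
/-- `q_ε(n, S)`: the number of eigenvalues (with multiplicity) outside the `ε`-expansion
`⋃_{z ∈ S} B(z, ε)` of `S`. -/
def numOutside {m : Type} [Fintype m] [DecidableEq m] (A : Matrix m m ℂ) (S : Set ℂ) (ε : ℝ) : ℕ :=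
  (eigs A).countP (fun z => z ∉ Metric.thickening ε S)

/-- `{A_n}` is weakly clustered at the nonempty closed set `S`, in the sense of the eigenvalues:
for each `ε > 0`, `q_ε(n, S) = o(d_n)`. -/
def WeaklyClustered (A : ∀ n, Matrix (ι n) (ι n) ℂ) (S : Set ℂ) : Prop :=
  Filter.Tendsto (fun n => Fintype.card (ι n)) Filter.atTop Filter.atTop ∧
  S.Nonempty ∧ IsClosed S ∧
  ∀ ε : ℝ, 0 < ε →
    (fun n => (numOutside (A n) S ε : ℝ)) =o[Filter.atTop] (fun n => (Fintype.card (ι n) : ℝ))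

end SpectralNotions

section Toeplitz

variable {r : ℕ}

/-- The `k`-th Fourier coefficient `(1/2π) ∫_{-π}^{π} f(θ) e^{-ikθ} dθ`, taken entrywise. -/
def fourierCoeffMatrix (f : ℝ → Matrix (Fin r) (Fin r) ℂ) (k : ℤ) : Matrix (Fin r) (Fin r) ℂ :=
  Matrix.of fun i j => (1 / (2 * (Real.pi : ℂ))) *
    ∫ θ in (-Real.pi)..Real.pi, f θ i j * Complex.exp (-(Complex.I * (k : ℂ) * (θ : ℂ)))

/-- The block Toeplitz matrix `T_n(f)`; `(k, i)` is row `i` of the `k`-th block row. -/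
def toeplitz (n : ℕ) (f : ℝ → Matrix (Fin r) (Fin r) ℂ) :
    Matrix (Fin n × Fin r) (Fin n × Fin r) ℂ :=
  Matrix.of fun p q => fourierCoeffMatrix f ((p.1.val : ℤ) - (q.1.val : ℤ)) p.2 q.2

end Toeplitz

section FEM

variable {r : ℕ}

/-- The local shape functions on the reference element `[0,1]`: the basis of the polynomials of
degree at most `r` that is dual to the evaluations at the nodes `ξ_0, …, ξ_r`. -/
def localShape (ξ : Fin (r + 1) → ℝ) (i : Fin (r + 1)) : Polynomial ℝ :=
  Lagrange.basis Finset.univ ξ i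

/-- The local-to-global map: local index `i` in the element `k` (elements counted from `0`).
The node `k * r + r` of element `k` is the node `(k + 1) * r` of element `k + 1`. -/
def ltg (r : ℕ) (i : Fin (r + 1)) (k : ℤ) : ℤ := k * r + (i.val : ℤ)

/-- The global shape function of the global index `m` on the uniform mesh of `[a,b]` with
`n` elements `[a + k h, a + (k + 1) h]`, `h = (b - a) / n`: on the element `k` it is the pull-back
`x ↦ ω_i ((x - a) / h - k)` of the local shape function `ω_i` with `LTG(i, k) = m`, and zero if
there is no such `i`. -/
def globalShape (a b : ℝ) (n : ℕ) (ξ : Fin (r + 1) → ℝ) (m : ℕ) (x : ℝ) : ℝ :=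
  ∑ i : Fin (r + 1),
    if ltg r i ⌊(x - a) / ((b - a) / n)⌋ = (m : ℤ) then
      (localShape ξ i).eval (Int.fract ((x - a) / ((b - a) / n)))
    else 0

/-- The Galerkin matrix of the bilinear form `∫_a^b c(x) u'(x) v'(x) dx` with homogeneous Dirichlet
conditions: rows and columns belong to the global indices `1, …, n r - 1`, those of the nodes
other than the two end points of `[a,b]`. -/
def galerkinMatrix (c : ℝ → ℝ) (a b : ℝ) (n : ℕ) (ξ : Fin (r + 1) → ℝ) :
    Matrix (Fin (n * r - 1)) (Fin (n * r - 1)) ℝ :=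
  Matrix.of fun p q => ∫ x in a..b,
    c x * deriv (globalShape a b n ξ (p.val + 1)) x * deriv (globalShape a b n ξ (q.val + 1)) x

/-- The stiffness matrix `A_n` for the diffusion coefficient `c`, in the normalization in which an
element contributes an integral over the reference element `[0,1]` without the Jacobian factor
`1 / h` of the change of variables, that is, `h = (b - a) / n` times the Galerkin matrix. -/
def stiffness (c : ℝ → ℝ) (a b : ℝ) (n : ℕ) (ξ : Fin (r + 1) → ℝ) :
    Matrix (Fin (n * r - 1)) (Fin (n * r - 1)) ℝ :=
  ((b - a) / n) • galerkinMatrix c a b n ξ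

/-- The stiffness matrix `A_n` for the coefficient `1`, with its entries regarded as complex. -/
def stiffnessSeq (a b : ℝ) (ξ : Fin (r + 1) → ℝ) (n : ℕ) :
    Matrix (Fin (n * r - 1)) (Fin (n * r - 1)) ℂ :=
  (stiffness (fun _ => 1) a b n ξ).map Complex.ofReal

/-- The local matrix `A^loc` for the unit coefficient. -/
def Aloc (ξ : Fin (r + 1) → ℝ) : Matrix (Fin (r + 1)) (Fin (r + 1)) ℝ :=
  Matrix.of fun i j => ∫ x in (0 : ℝ)..1,
    (localShape ξ i).derivative.eval x * (localShape ξ j).derivative.eval x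

/-- `A_ξ`: the local matrix with both corner entries on the diagonal replaced by their sum. -/
def Axi (ξ : Fin (r + 1) → ℝ) : Matrix (Fin (r + 1)) (Fin (r + 1)) ℝ :=
  Matrix.of fun i j =>
    if (i = 0 ∧ j = 0) ∨ (i = Fin.last r ∧ j = Fin.last r) then
      Aloc ξ 0 0 + Aloc ξ (Fin.last r) (Fin.last r)
    else Aloc ξ i j

/-- `α_ξ`: the leading `r × r` block of `A_ξ`. -/
def alphaXi (ξ : Fin (r + 1) → ℝ) : Matrix (Fin r) (Fin r) ℝ :=
  (Axi ξ).submatrix Fin.castSucc Fin.castSucc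

/-- `β_ξ`: first row equal to the first `r` entries of the last row of `A_ξ`, other rows zero. -/
def betaXi (ξ : Fin (r + 1) → ℝ) : Matrix (Fin r) (Fin r) ℝ :=
  Matrix.of fun i j => if i.val = 0 then Axi ξ (Fin.last r) j.castSucc else 0

/-- The symbol `f_r^ξ(θ) = α_ξ + β_ξ e^{iθ} + β_ξᵀ e^{-iθ}`. -/
def symbol (ξ : Fin (r + 1) → ℝ) (θ : ℝ) : Matrix (Fin r) (Fin r) ℂ :=
  (alphaXi ξ).map Complex.ofReal
    + Complex.exp (Complex.I * (θ : ℂ)) • (betaXi ξ).map Complex.ofReal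
    + Complex.exp (-(Complex.I * (θ : ℂ))) • ((betaXi ξ)ᵀ).map Complex.ofReal

lemma Aloc_symm (ξ : Fin (r + 1) → ℝ) (i j : Fin (r + 1)) : Aloc ξ i j = Aloc ξ j i := by
  simp only [Aloc, Matrix.of_apply]
  congr 1
  funext x
  ring

lemma Axi_symm (ξ : Fin (r + 1) → ℝ) (i j : Fin (r + 1)) : Axi ξ i j = Axi ξ j i := by
  simp only [Axi, Matrix.of_apply, Aloc_symm ξ i j,
    and_comm (a := i = 0) (b := j = 0), and_comm (a := i = Fin.last r) (b := j = Fin.last r)]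

lemma symbol_isHermitian (ξ : Fin (r + 1) → ℝ) (θ : ℝ) : (symbol ξ θ).IsHermitian := by
  ext i j
  simp only [symbol, alphaXi, Matrix.conjTranspose_apply, Matrix.add_apply, Matrix.smul_apply,
    Matrix.map_apply, Matrix.submatrix_apply, Matrix.transpose_apply, smul_eq_mul, star_add,
    star_mul', Complex.star_def, Complex.conj_ofReal, ← Complex.exp_conj, map_mul, map_neg,
    Complex.conj_I, Axi_symm ξ j.castSucc i.castSucc]
  ring_nf

/-- The `j`-th eigenvalue function of the symbol (zero-based, nondecreasing order):
`λ_0(f(θ)) ≤ … ≤ λ_{r-1}(f(θ))`. -/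
def eigFun (ξ : Fin (r + 1) → ℝ) (j : Fin r) (θ : ℝ) : ℝ :=
  (symbol_isHermitian ξ θ).eigenvalues₀ (Fin.cast (Fintype.card_fin r).symm j.rev)

/-- The union over `j` of the ranges of the eigenvalue functions on `[-π, π]`, as a subset of
the complex plane. -/
def eigRange (ξ : Fin (r + 1) → ℝ) : Set ℂ :=
  ⋃ j : Fin r, (fun θ : ℝ => (eigFun ξ j θ : ℂ)) '' Set.Icc (-Real.pi) Real.pi

/-- The Toeplitz matrix `T_n(f_r^ξ)` of the symbol. -/
def toeplitzSeq (ξ : Fin (r + 1) → ℝ) (n : ℕ) : Matrix (Fin n × Fin r) (Fin n × Fin r) ℂ :=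
  toeplitz n (symbol ξ)

/-- The `n r - 1` indices of `T_n(f)` other than the very first one: `m` is sent to the
index that comes at position `m + 1` (from `0`) in the lexicographic order. -/
def interiorIndex (n r : ℕ) (m : Fin (n * r - 1)) : Fin n × Fin r :=
  finProdFinEquiv.symm ⟨m.val + 1, by omega⟩

end FEM

end WeightsFEM

end

open WeightsFEM

/-! The distribution statements follow by the method of moments. The symbol is a trigonometric
polynomial of degree one, so `T_n(f)` is block tridiagonal and `T_n(g) T_n(f)` differs from `T_n(g
f)` only in the first and last block columns. By induction the trace of `T_n(f)^m` is that of
`T_n(f^m)`, namely `n` times the mean of `tr f^m`, up to an error independent of `n`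
(`norm_trace_toeplitz_pow_mul_sub_le`). Deleting one row and column changes this trace by another
bounded amount (`norm_trace_pow_sub_trace_pow_submatrix_le`), so `A_n` has the same limit moments.

Absolute row sums are the working norm: they are submultiplicative, pass to submatrices and bound
the spectrum by Gershgorin. All spectra thus lie in one interval `[-K, K]`, where Weierstrass
approximation extends the limit from powers to continuous test functions
(`eigenvalueDistribution_of_moments`). Singular values of Hermitian matrices are the moduli of the
eigenvalues, and clustering follows by testing with a Urysohn function.

The link between `A_n` and `T_n(f)` is finite element assembly (`stiffness_one_apply`,
`sum_local_eq`): the last node of an element is the first node of the next, which produces the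
summed corner of `α_ξ` and the single row of `β_ξ`. Only node `0` lacks a left-hand element, and its
row and column are the deleted ones. -/

noncomputable section

namespace WeightsFEM

/-! ### Absolute row sums -/

section RowSums

variable {l m n : Type} [Fintype n]

/-- Every row of `A` has absolute sum at most `K`. -/
def RowSumLE (A : Matrix m n ℂ) (K : ℝ) : Prop := ∀ i, ∑ j, ‖A i j‖ ≤ K

lemma RowSumLE.norm_le {A : Matrix m n ℂ} {K : ℝ} (hA : RowSumLE A K) (i : m) (j : n) :
    ‖A i j‖ ≤ K :=
  (Finset.single_le_sum (f := fun j => ‖A i j‖) (fun _ _ => norm_nonneg _)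
    (Finset.mem_univ j)).trans (hA i)

lemma RowSumLE.mul [Fintype m] {A : Matrix l m ℂ} {B : Matrix m n ℂ} {a b : ℝ} (hA : RowSumLE A a)
    (hB : RowSumLE B b) (hb : 0 ≤ b) : RowSumLE (A * B) (a * b) := by
  intro i
  calc ∑ k, ‖(A * B) i k‖ ≤ ∑ k, ∑ j, ‖A i j‖ * ‖B j k‖ := by
        refine Finset.sum_le_sum fun k _ => ?_
        rw [Matrix.mul_apply]
        exact (norm_sum_le _ _).trans (Finset.sum_le_sum fun j _ => (norm_mul _ _).le)
    _ = ∑ j, ‖A i j‖ * ∑ k, ‖B j k‖ := by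
        rw [Finset.sum_comm]
        simp only [Finset.mul_sum]
    _ ≤ ∑ j, ‖A i j‖ * b :=
        Finset.sum_le_sum fun j _ => mul_le_mul_of_nonneg_left (hB j) (norm_nonneg _)
    _ = (∑ j, ‖A i j‖) * b := by rw [Finset.sum_mul]
    _ ≤ a * b := mul_le_mul_of_nonneg_right (hA i) hb

lemma RowSumLE.one [Fintype m] [DecidableEq m] : RowSumLE (1 : Matrix m m ℂ) 1 := by
  intro i
  have h : ∀ j, ‖(1 : Matrix m m ℂ) i j‖ = if i = j then 1 else 0 := by
    intro j
    rw [Matrix.one_apply]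
    split_ifs <;> simp
  simp [h]

lemma RowSumLE.pow [Fintype m] [DecidableEq m] {A : Matrix m m ℂ} {K : ℝ} (hA : RowSumLE A K) (hK : 0 ≤ K)
    (k : ℕ) : RowSumLE (A ^ k) (K ^ k) := by
  induction k with
  | zero => simpa using RowSumLE.one
  | succ k ih => rw [pow_succ, pow_succ]; exact ih.mul hA hK

lemma RowSumLE.submatrix [Fintype m] {A : Matrix m m ℂ} {K : ℝ} (hA : RowSumLE A K) {e : n → m}
    (he : Function.Injective e) : RowSumLE (A.submatrix e e) K := by
  intro i
  classical
  calc ∑ j, ‖A (e i) (e j)‖ = ∑ x ∈ Finset.univ.image e, ‖A (e i) x‖ := by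
        rw [Finset.sum_image he.injOn]
    _ ≤ ∑ x, ‖A (e i) x‖ :=
        Finset.sum_le_univ_sum_of_nonneg fun _ => norm_nonneg _
    _ ≤ K := hA _

end RowSums

/-! ### Spectra and singular values of Hermitian matrices -/

section Spectral

variable {m : Type} [Fintype m] [DecidableEq m] {A : Matrix m m ℂ}

lemma sum_map_eigs (hA : A.IsHermitian) (F : ℂ → ℂ) :
    ((eigs A).map F).sum = ∑ i, F (hA.eigenvalues i : ℂ) := by
  rw [eigs, hA.roots_charpoly_eq_eigenvalues, Multiset.map_map]
  rfl

/-- Gershgorin: `z` lies in a disc around a diagonal entry whose radius is the rest of that absolute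
row sum. -/
lemma norm_le_of_mem_eigs {K : ℝ} (hA : RowSumLE A K) {z : ℂ} (hz : z ∈ eigs A) : ‖z‖ ≤ K := by
  have h1 : Module.End.HasEigenvalue (Matrix.toLin' A) z := by
    rw [Module.End.hasEigenvalue_iff_isRoot_charpoly, Matrix.charpoly_toLin']
    exact Polynomial.isRoot_of_mem_roots hz
  obtain ⟨k, hk⟩ := eigenvalue_mem_ball h1
  rw [mem_closedBall_iff_norm] at hk
  calc ‖z‖ = ‖A k k + (z - A k k)‖ := by ring_nf
    _ ≤ ‖A k k‖ + ‖z - A k k‖ := norm_add_le _ _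
    _ ≤ ‖A k k‖ + ∑ j ∈ Finset.univ.erase k, ‖A k j‖ := by gcongr
    _ = ∑ j, ‖A k j‖ := Finset.add_sum_erase _ (fun j => ‖A k j‖) (Finset.mem_univ k)
    _ ≤ K := hA k

lemma eigenvalues_mem_eigs (hA : A.IsHermitian) (i : m) : (hA.eigenvalues i : ℂ) ∈ eigs A := by
  rw [eigs, hA.roots_charpoly_eq_eigenvalues]
  exact Multiset.mem_map_of_mem _ (Finset.mem_univ i)

lemma abs_eigenvalues_le {K : ℝ} (hA : A.IsHermitian) (hK : RowSumLE A K) (i : m) :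
    |hA.eigenvalues i| ≤ K := by
  simpa using norm_le_of_mem_eigs hK (eigenvalues_mem_eigs hA i)

lemma spectral_pow (hA : A.IsHermitian) (k : ℕ) :
    A ^ k = (hA.eigenvectorUnitary : Matrix m m ℂ) *
      Matrix.diagonal (fun i => (hA.eigenvalues i : ℂ) ^ k) *
      (star hA.eigenvectorUnitary : Matrix m m ℂ) := by
  have h := hA.spectral_theorem
  conv_lhs => rw [h]
  rw [← map_pow, Unitary.conjStarAlgAut_apply, Matrix.diagonal_pow]
  rfl

lemma trace_pow_eq_sum (hA : A.IsHermitian) (k : ℕ) :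
    (A ^ k).trace = ∑ i, (hA.eigenvalues i : ℂ) ^ k := by
  rw [spectral_pow hA k, Matrix.trace_mul_comm, ← mul_assoc, Unitary.coe_star_mul_self, one_mul,
    Matrix.trace_diagonal]

lemma sum_eval_eigenvalues (hA : A.IsHermitian) (p : Polynomial ℂ) :
    ∑ i, p.eval (hA.eigenvalues i : ℂ) =
      ∑ k ∈ Finset.range (p.natDegree + 1), p.coeff k * (A ^ k).trace := by
  simp only [Polynomial.eval_eq_sum_range, trace_pow_eq_sum hA, Finset.mul_sum]
  exact Finset.sum_comm

lemma eigs_sq (hA : A.IsHermitian) :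
    eigs (A ^ 2) = Finset.univ.val.map (fun i => (hA.eigenvalues i : ℂ) ^ 2) := by
  rw [eigs, spectral_pow hA 2, Matrix.charpoly_mul_comm, ← mul_assoc, Unitary.coe_star_mul_self,
    one_mul, Matrix.charpoly_diagonal]
  convert Polynomial.roots_multiset_prod_X_sub_C
    (Finset.univ.val.map (fun i => (hA.eigenvalues i : ℂ) ^ 2)) using 2
  rw [Multiset.map_map]
  rfl

/-- For Hermitian `A` the operator `T* T` is that of `A ^ 2`. Comparing roots of characteristic
polynomials as multisets avoids matching the orderings of singular values and eigenvalues. -/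
lemma map_sv_sq (hA : A.IsHermitian) :
    (Finset.range (Fintype.card m)).val.map (fun k => ((sv A k ^ 2 : ℝ) : ℂ)) = eigs (A ^ 2) := by
  have hn : Module.finrank ℂ (EuclideanSpace ℂ m) = Fintype.card m := by simp
  set T := Matrix.toEuclideanLin A with hT
  have hcomp : LinearMap.adjoint T ∘ₗ T = Matrix.toEuclideanLin (A ^ 2) := by
    rw [hT, ← Matrix.toEuclideanLin_conjTranspose_eq_adjoint, hA.eq, pow_two]
    ext v i
    simp [Matrix.toLpLin_apply]
  have hch : (LinearMap.adjoint T ∘ₗ T).charpoly = (A ^ 2).charpoly := by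
    rw [hcomp, Matrix.toEuclideanLin_eq_toLin_orthonormal, Matrix.charpoly_toLin]
  rw [eigs, ← hch, T.isSymmetric_adjoint_comp_self.roots_charpoly_eq_eigenvalues hn]
  have h : (RCLike.ofReal : ℝ → ℂ) ∘ T.isSymmetric_adjoint_comp_self.eigenvalues hn
      = (fun k : ℕ => ((sv A k ^ 2 : ℝ) : ℂ)) ∘ Fin.valEmbedding := by
    funext i
    simp only [Function.comp_apply, sv, Fin.valEmbedding_apply, ← hT]
    rw [← T.sq_singularValues_fin hn i]
    rfl
  rw [h, ← Multiset.map_map, ← Finset.map_val, Fin.map_valEmbedding_univ, Nat.Iio_eq_range]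

lemma sum_sv (hA : A.IsHermitian) (F : ℝ → ℂ) :
    ∑ k ∈ Finset.range (Fintype.card m), F (sv A k) =
      ((eigs A).map (fun z => F ‖z‖)).sum := by
  -- Square roots recover the singular values, which are nonnegative, on one side and `|λ|` from `λ
  -- ^ 2` on the other.
  have h := congrArg (fun s => (s.map (fun z : ℂ => F (Real.sqrt z.re))).sum)
    ((map_sv_sq hA).trans (eigs_sq hA))
  simp only [Multiset.map_map, Function.comp_def] at h
  rw [sum_map_eigs hA]
  convert h using 1
  · refine Finset.sum_congr rfl fun k _ => ?_
    rw [Complex.ofReal_re, Real.sqrt_sq]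
    exact LinearMap.singularValues_nonneg _ _
  · refine Finset.sum_congr rfl fun i _ => ?_
    rw [← Complex.ofReal_pow, Complex.ofReal_re, Real.sqrt_sq_eq_abs]
    simp

end Spectral

/-! ### From moments to distributions and clusters -/

section Moments

lemma exists_polynomial_near_of_continuous {G : ℂ → ℂ} (hG : Continuous G) (K : ℝ) {ε : ℝ}
    (hε : 0 < ε) : ∃ p : Polynomial ℂ, ∀ t : ℝ, |t| ≤ K → ‖G t - p.eval (t : ℂ)‖ ≤ ε := by
  have hG' : Continuous fun t : ℝ => G t := hG.comp Complex.continuous_ofReal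
  obtain ⟨p, hp⟩ := exists_polynomial_near_of_continuousOn (-K) K (fun t => (G t).re)
    (Complex.continuous_re.comp hG').continuousOn (ε / 2) (half_pos hε)
  obtain ⟨q, hq⟩ := exists_polynomial_near_of_continuousOn (-K) K (fun t => (G t).im)
    (Complex.continuous_im.comp hG').continuousOn (ε / 2) (half_pos hε)
  refine ⟨p.map Complex.ofRealHom + Polynomial.C Complex.I * q.map Complex.ofRealHom,
    fun t ht => ?_⟩
  have hev : ∀ s : Polynomial ℝ, (s.map Complex.ofRealHom).eval (t : ℂ) = (s.eval t : ℝ) := by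
    intro s
    rw [Polynomial.eval_map, ← Complex.ofRealHom_eq_coe, Polynomial.eval₂_at_apply]
    rfl
  have h1 := hp t (abs_le.mp ht)
  have h2 := hq t (abs_le.mp ht)
  rw [Polynomial.eval_add, Polynomial.eval_mul, Polynomial.eval_C, hev, hev]
  refine (Complex.norm_le_abs_re_add_abs_im _).trans ?_
  simp only [Complex.sub_re, Complex.add_re, Complex.ofReal_re, Complex.mul_re, Complex.I_re,
    Complex.ofReal_im, Complex.I_im, Complex.sub_im, Complex.add_im, Complex.mul_im]
  rw [abs_sub_comm] at h1 h2
  ring_nf at h1 h2 ⊢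
  linarith

variable {r : ℕ} {f : ℝ → Matrix (Fin r) (Fin r) ℂ} {K : ℝ}

lemma sum_map_eigs_sub {m : Type} [Fintype m] [DecidableEq m] {A : Matrix m m ℂ}
    (hA : A.IsHermitian) (hK : RowSumLE A K) {F G : ℂ → ℂ} {ε : ℝ}
    (h : ∀ t : ℝ, |t| ≤ K → ‖F t - G t‖ ≤ ε) :
    ‖((eigs A).map F).sum - ((eigs A).map G).sum‖ ≤ Fintype.card m * ε := by
  rw [sum_map_eigs hA, sum_map_eigs hA, ← Finset.sum_sub_distrib]
  refine (norm_sum_le_of_le _ fun i _ => h _ (abs_eigenvalues_le hA hK i)).trans ?_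
  simp

lemma sum_map_eigs_eval {m : Type} [Fintype m] [DecidableEq m] {A : Matrix m m ℂ}
    (hA : A.IsHermitian) (p : Polynomial ℂ) :
    ((eigs A).map (fun z => p.eval z)).sum =
      ∑ k ∈ Finset.range (p.natDegree + 1), p.coeff k * (A ^ k).trace := by
  rw [sum_map_eigs hA, sum_eval_eigenvalues hA]

/-- For polynomial `F` the sum is a combination of traces of powers, hence continuous in `θ`; the
general case is a uniform limit of these. Continuity of the individual eigenvalues is not needed. -/
lemma continuous_sum_eigs (hf : Continuous f) (hH : ∀ θ, (f θ).IsHermitian)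
    (hK : ∀ θ, RowSumLE (f θ) K) {F : ℂ → ℂ} (hF : Continuous F) :
    Continuous fun θ => ((eigs (f θ)).map F).sum := by
  refine continuous_of_uniform_approx_of_continuous fun u hu => ?_
  obtain ⟨ε, hε, hεu⟩ := Metric.mem_uniformity_dist.mp hu
  -- Dividing by `r + 1` covers `r = 0` and makes the final estimate strict.
  have hr : (0 : ℝ) < r + 1 := by positivity
  obtain ⟨p, hp⟩ := exists_polynomial_near_of_continuous hF K (div_pos hε hr)
  refine ⟨fun θ => ((eigs (f θ)).map fun z => p.eval z).sum, ?_, fun θ => hεu ?_⟩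
  · simp only [sum_map_eigs_eval (hH _)]
    fun_prop
  · rw [dist_eq_norm]
    refine (sum_map_eigs_sub (hH θ) (hK θ) hp).trans_lt ?_
    rw [Fintype.card_fin, ← mul_div_assoc, div_lt_iff₀ hr]
    nlinarith

lemma isSymbol_of_continuous (hr : 1 ≤ r) (hf : Continuous f) :
    IsSymbol (Set.Icc (-Real.pi) Real.pi) f := by
  refine ⟨hr, measurableSet_Icc.nullMeasurableSet, ?_, ?_, fun i j => ?_⟩
  · simp [Real.volume_Icc, Real.pi_pos]
  · simp [Real.volume_Icc]
  · exact (hf.matrix_elem i j).measurable.aemeasurable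

variable {ι : ℕ → Type} [∀ n, Fintype (ι n)] [∀ n, DecidableEq (ι n)]
  {X : ∀ n, Matrix (ι n) (ι n) ℂ}

/-- The eigenvalue distribution of uniformly bounded Hermitian matrices is determined by the
limits of the normalized traces of their powers. -/
theorem eigenvalueDistribution_of_moments (hr : 1 ≤ r) (hf : Continuous f)
    (hH : ∀ θ, (f θ).IsHermitian) (hK : ∀ θ, RowSumLE (f θ) K)
    (hXH : ∀ n, (X n).IsHermitian) (hXK : ∀ n, RowSumLE (X n) K)
    (hcard : Filter.Tendsto (fun n => Fintype.card (ι n)) Filter.atTop Filter.atTop)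
    (hmom : ∀ k : ℕ, Filter.Tendsto (fun n => (1 / (Fintype.card (ι n) : ℂ)) * (X n ^ k).trace)
      Filter.atTop (𝓝 ((1 / ((volume.real (Set.Icc (-Real.pi) Real.pi) : ℝ) : ℂ)) *
        ∫ θ in Set.Icc (-Real.pi) Real.pi, (f θ ^ k).trace / (r : ℂ)))) :
    EigenvalueDistribution X (Set.Icc (-Real.pi) Real.pi) f := by
  refine ⟨isSymbol_of_continuous hr hf, hcard, fun F hF _ => ?_⟩
  set D := Set.Icc (-Real.pi) Real.pi with hD
  have hvol : volume.real D = 2 * Real.pi := by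
    rw [hD, Real.volume_real_Icc_of_le (by linarith [Real.pi_pos])]; ring
  have hπ : 0 < 2 * Real.pi := by positivity
  have hr0 : (0 : ℝ) < r := by exact_mod_cast hr
  have hint : ∀ g : ℝ → ℂ, Continuous g → MeasureTheory.IntegrableOn g D volume :=
    fun g hg => hg.continuousOn.integrableOn_compact isCompact_Icc
  have hpoly : ∀ p : Polynomial ℂ, Filter.Tendsto
      (fun n => (1 / (Fintype.card (ι n) : ℂ)) * ((eigs (X n)).map fun z => p.eval z).sum)
      Filter.atTop (𝓝 ((1 / ((volume.real D : ℝ) : ℂ)) *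
        ∫ θ in D, ((eigs (f θ)).map fun z => p.eval z).sum / (r : ℂ))) := by
    intro p
    have h := tendsto_finsetSum (Finset.range (p.natDegree + 1))
      fun k _ => (hmom k).const_mul (p.coeff k)
    refine (h.congr fun n => ?_).trans (le_of_eq (congrArg 𝓝 ?_))
    · rw [sum_map_eigs_eval (hXH n), Finset.mul_sum]
      exact Finset.sum_congr rfl fun k _ => by ring
    · simp only [sum_map_eigs_eval (hH _), Finset.sum_div]
      rw [MeasureTheory.integral_finsetSum _ fun k _ => hint _ (by fun_prop), Finset.mul_sum]
      refine Finset.sum_congr rfl fun k _ => ?_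
      simp only [mul_div_assoc]
      rw [MeasureTheory.integral_const_mul]
      ring
  rw [Metric.tendsto_atTop]
  intro ε hε
  -- Replacing `F` by `p` costs `ε / 4` for the matrices and `ε / 4` for the symbol; convergence for
  -- `p` costs a third `ε / 4`.
  obtain ⟨p, hp⟩ := exists_polynomial_near_of_continuous hF K (show 0 < ε / 4 by positivity)
  obtain ⟨N, hN⟩ := Metric.tendsto_atTop.mp (hpoly p) (ε / 4) (by positivity)
  refine ⟨N, fun n hn => ?_⟩
  have h1 : ‖(1 / (Fintype.card (ι n) : ℂ)) * ((eigs (X n)).map F).sum -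
      (1 / (Fintype.card (ι n) : ℂ)) * ((eigs (X n)).map fun z => p.eval z).sum‖ ≤ ε / 4 := by
    rw [← mul_sub, norm_mul, norm_div, norm_one, Complex.norm_natCast]
    refine (mul_le_mul_of_nonneg_left (sum_map_eigs_sub (hXH n) (hXK n) hp) (by positivity)).trans ?_
    rw [← mul_assoc]
    refine mul_le_of_le_one_left (by positivity) ?_
    rw [one_div]
    -- This also covers an empty index type, since `0⁻¹ * 0 = 0`.
    exact inv_mul_le_one
  have h2 : ‖(1 / ((volume.real D : ℝ) : ℂ)) *
        (∫ θ in D, ((eigs (f θ)).map fun z => p.eval z).sum / (r : ℂ)) -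
      (1 / ((volume.real D : ℝ) : ℂ)) * ∫ θ in D, ((eigs (f θ)).map F).sum / (r : ℂ)‖ ≤ ε / 4 := by
    rw [← mul_sub, ← MeasureTheory.integral_sub
      (hint _ ((continuous_sum_eigs hf hH hK p.continuous).div_const _))
      (hint _ ((continuous_sum_eigs hf hH hK hF).div_const _)), norm_mul, norm_div, norm_one,
      Complex.norm_real, Real.norm_of_nonneg (by rw [hvol]; positivity)]
    have := MeasureTheory.norm_setIntegral_le_of_norm_le_const (μ := volume) (s := D) (C := ε / 4)
      (f := fun θ => ((eigs (f θ)).map fun z => p.eval z).sum / (r : ℂ) -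
        ((eigs (f θ)).map F).sum / (r : ℂ)) (by simp [hD]) (fun θ _ => by
        rw [← sub_div, norm_div, Complex.norm_natCast, div_le_iff₀ hr0, norm_sub_rev]
        refine (sum_map_eigs_sub (hH θ) (hK θ) hp).trans (le_of_eq ?_)
        rw [Fintype.card_fin, mul_comm])
    rw [hvol] at this ⊢
    rw [one_div, inv_mul_le_iff₀ hπ, mul_comm]
    exact this
  have h3 := hN n hn
  rw [← dist_eq_norm] at h1 h2
  refine (dist_triangle4 _ _ _ _).trans_lt ((add_lt_add_of_lt_of_le
    (add_lt_add_of_le_of_lt h1 h3) h2).trans ?_)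
  linarith

/-- For Hermitian matrices and a Hermitian symbol, an eigenvalue distribution is also a singular
value distribution. -/
theorem EigenvalueDistribution.singularValueDistribution {D : Set ℝ}
    (h : EigenvalueDistribution X D f)
    (hH : ∀ θ, (f θ).IsHermitian) (hXH : ∀ n, (X n).IsHermitian) :
    SingularValueDistribution X D f := by
  obtain ⟨h1, h2, h3⟩ := h
  refine ⟨h1, h2, fun F hF hFc => ?_⟩
  have h4 := h3 (fun z => F ‖z‖) (by fun_prop) ?_
  · simp only [← sum_sv (hXH _), ← sum_sv (hH _), Fintype.card_fin] at h4
    exact h4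
  · obtain ⟨R, hR⟩ := hFc.isCompact.isBounded.exists_norm_le
    refine HasCompactSupport.intro (isCompact_closedBall (0 : ℂ) R) fun z hz => ?_
    by_contra hne
    refine hz ?_
    have := hR ‖z‖ (subset_tsupport F hne)
    simpa using this

/-- Bounded matrices with an eigenvalue distribution are weakly clustered at each closed set that
contains the spectra of the symbol. -/
theorem EigenvalueDistribution.weaklyClustered {D : Set ℝ} {S : Set ℂ}
    (h : EigenvalueDistribution X D f) (hXK : ∀ n, RowSumLE (X n) K)
    (hS : IsClosed S) (hne : S.Nonempty)
    (hfS : ∀ θ ∈ D, ∀ z ∈ eigs (f θ), z ∈ S) : WeaklyClustered X S := by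
  obtain ⟨-, hcard, hlim⟩ := h
  refine ⟨hcard, hne, hS, fun ε hε => ?_⟩
  -- The spectra lie in the ball of radius `K`, so every outlier has `φ = 1` and the sum of `φ` over
  -- the eigenvalues bounds their number. As `φ = 0` on `S`, the limit integral vanishes.
  obtain ⟨φ, hφ1, hφ0, hφc, hφ⟩ := exists_continuous_one_zero_of_isCompact
    (s := Metric.closedBall (0 : ℂ) K \ Metric.thickening ε S) (t := S)
    ((isCompact_closedBall _ _).diff Metric.isOpen_thickening) hS (by
      rw [Set.disjoint_left]
      exact fun z hz hzS => hz.2 (Metric.self_subset_thickening hε S hzS))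
  have hl := hlim (fun z => (φ z : ℂ)) (by fun_prop) (hφc.comp_left (g := Complex.ofReal) rfl)
  have hzero : ∫ x in D, ((eigs (f x)).map fun z => (φ z : ℂ)).sum / (r : ℂ) = 0 := by
    refine MeasureTheory.setIntegral_eq_zero_of_forall_eq_zero fun θ hθ => ?_
    rw [Multiset.sum_eq_zero, zero_div]
    intro y hy
    obtain ⟨z, hz, rfl⟩ := Multiset.mem_map.mp hy
    have := hφ0 (hfS θ hθ z hz)
    simp_all
  rw [hzero, mul_zero] at hl
  have hl' := hl.norm
  rw [norm_zero] at hl'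
  have hle : ∀ n, (numOutside (X n) S ε : ℝ) ≤ ((eigs (X n)).map φ).sum := by
    intro n
    -- The decidability instance is left arbitrary so that the bound fits the classical one in
    -- `numOutside`.
    have key : ∀ [DecidablePred fun z : ℂ => z ∉ Metric.thickening ε S] (s : Multiset ℂ),
        (∀ z ∈ s, ‖z‖ ≤ K) →
        ((s.countP fun z => z ∉ Metric.thickening ε S : ℕ) : ℝ) ≤ (s.map φ).sum := by
      intro _ s
      induction s using Multiset.induction_on with
      | empty => simp
      | cons a s ih =>
        intro hs
        have h1 := ih fun z hz => hs z (Multiset.mem_cons_of_mem hz)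
        rw [Multiset.map_cons, Multiset.sum_cons, Multiset.countP_cons]
        by_cases ha : a ∉ Metric.thickening ε S
        · have : φ a = 1 := hφ1 ⟨by simpa using hs a (Multiset.mem_cons_self a s), ha⟩
          rw [if_pos ha]
          push_cast
          linarith
        · have := (hφ a).1
          rw [if_neg ha]
          push_cast
          linarith
    rw [numOutside]
    exact @key (_) _ fun z hz => norm_le_of_mem_eigs (hXK n) hz
  rw [Asymptotics.isLittleO_iff_tendsto']
  · refine squeeze_zero (fun n => by positivity) (fun n => ?_) hl'
    have hcast : ((eigs (X n)).map fun z => (φ z : ℂ)).sum = (((eigs (X n)).map φ).sum : ℝ) := by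
      have := map_multiset_sum Complex.ofRealHom ((eigs (X n)).map φ)
      rw [Multiset.map_map] at this
      exact this.symm
    rw [hcast, norm_mul, norm_div, norm_one, Complex.norm_natCast, Complex.norm_real,
      Real.norm_of_nonneg ((Nat.cast_nonneg _).trans (hle n)), one_div, inv_mul_eq_div]
    gcongr
    exact hle n
  · filter_upwards [hcard.eventually_ge_atTop 1] with n hn h0
    have : Fintype.card (ι n) = 0 := by exact_mod_cast h0
    omega

end Moments

/-! ### Fourier coefficients of matrix-valued functions -/

section FourierCoefficients

variable {r : ℕ}

/-- The trigonometric polynomial `a + b e^{iθ} + c e^{-iθ}` with matrix coefficients. -/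
def trigSymbol (a b c : Matrix (Fin r) (Fin r) ℂ) (θ : ℝ) : Matrix (Fin r) (Fin r) ℂ :=
  a + Complex.exp (Complex.I * (θ : ℂ)) • b + Complex.exp (-(Complex.I * (θ : ℂ))) • c

lemma continuous_trigSymbol (a b c : Matrix (Fin r) (Fin r) ℂ) :
    Continuous (trigSymbol a b c) := by
  unfold trigSymbol
  fun_prop

/-- Multiplication by `e^{iθ}` turns `e^{-ikθ}` into `e^{-i(k-1)θ}`, so each factor `e^{±iθ}` only
shifts the coefficient index. -/
lemma fourierCoeffMatrix_mul_trigSymbol {g : ℝ → Matrix (Fin r) (Fin r) ℂ} (hg : Continuous g)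
    (a b c : Matrix (Fin r) (Fin r) ℂ) (k : ℤ) :
    fourierCoeffMatrix (fun θ => g θ * trigSymbol a b c θ) k =
      fourierCoeffMatrix g k * a + fourierCoeffMatrix g (k - 1) * b +
        fourierCoeffMatrix g (k + 1) * c := by
  ext s t
  set h : ℤ → Fin r → ℝ → ℂ :=
    fun k u θ => g θ s u * Complex.exp (-(Complex.I * (k : ℂ) * (θ : ℂ))) with hh
  have hc : ∀ k u, Continuous (h k u) := by
    intro k u
    have := hg.matrix_elem s u
    fun_prop
  have hi : ∀ k u (z : ℂ), IntervalIntegrable (fun θ => h k u θ * z) volume (-Real.pi) Real.pi :=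
    fun k u z => ((hc k u).mul continuous_const).intervalIntegrable _ _
  have key : ∀ θ : ℝ, (g θ * trigSymbol a b c θ) s t *
      Complex.exp (-(Complex.I * (k : ℂ) * (θ : ℂ))) =
      ∑ u, (h k u θ * a u t + h (k - 1) u θ * b u t + h (k + 1) u θ * c u t) := by
    intro θ
    rw [Matrix.mul_apply, Finset.sum_mul]
    refine Finset.sum_congr rfl fun u _ => ?_
    have e1 : Complex.exp (-(Complex.I * ((k - 1 : ℤ) : ℂ) * (θ : ℂ))) =
        Complex.exp (Complex.I * (θ : ℂ)) * Complex.exp (-(Complex.I * (k : ℂ) * (θ : ℂ))) := by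
      rw [← Complex.exp_add]; congr 1; push_cast; ring
    have e2 : Complex.exp (-(Complex.I * ((k + 1 : ℤ) : ℂ) * (θ : ℂ))) =
        Complex.exp (-(Complex.I * (θ : ℂ))) * Complex.exp (-(Complex.I * (k : ℂ) * (θ : ℂ))) := by
      rw [← Complex.exp_add]; congr 1; push_cast; ring
    simp only [hh, e1, e2, trigSymbol, Matrix.add_apply, Matrix.smul_apply, smul_eq_mul]
    ring
  simp only [Matrix.add_apply, Matrix.mul_apply]
  simp only [fourierCoeffMatrix, Matrix.of_apply, key]
  rw [intervalIntegral.integral_finsetSum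
    fun u _ => ((hi k u _).add (hi (k - 1) u _)).add (hi (k + 1) u _), Finset.mul_sum,
    ← Finset.sum_add_distrib, ← Finset.sum_add_distrib]
  refine Finset.sum_congr rfl fun u _ => ?_
  rw [intervalIntegral.integral_add ((hi k u _).add (hi (k - 1) u _)) (hi (k + 1) u _),
    intervalIntegral.integral_add (hi k u _) (hi (k - 1) u _)]
  simp only [intervalIntegral.integral_mul_const]
  simp only [hh]
  ring

lemma fourierCoeffMatrix_one (k : ℤ) :
    fourierCoeffMatrix (fun _ => (1 : Matrix (Fin r) (Fin r) ℂ)) k = if k = 0 then 1 else 0 := by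
  have hπ : (Real.pi : ℂ) ≠ 0 := by exact_mod_cast Real.pi_ne_zero
  ext s t
  simp only [fourierCoeffMatrix, Matrix.of_apply, intervalIntegral.integral_const_mul]
  split_ifs with hk
  · subst hk
    simp only [Int.cast_zero, mul_zero, zero_mul, neg_zero, Complex.exp_zero,
      intervalIntegral.integral_const, sub_neg_eq_add, Complex.real_smul]
    push_cast
    field_simp
    ring
  · have hk' : -(Complex.I * (k : ℂ)) ≠ 0 := by simp [hk]
    have : (∫ θ in (-Real.pi)..Real.pi, Complex.exp (-(Complex.I * (k : ℂ) * (θ : ℂ)))) = 0 := by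
      simp only [← neg_mul]
      simp only [neg_mul Complex.I]
      rw [integral_exp_mul_complex hk', div_eq_zero_iff]
      left
      rw [sub_eq_zero, Complex.exp_eq_exp_iff_exists_int]
      exact ⟨-k, by push_cast; ring⟩
    rw [this]
    simp

lemma fourierCoeffMatrix_trigSymbol (a b c : Matrix (Fin r) (Fin r) ℂ) (k : ℤ) :
    fourierCoeffMatrix (trigSymbol a b c) k =
      if k = 0 then a else if k = 1 then b else if k = -1 then c else 0 := by
  have h := fourierCoeffMatrix_mul_trigSymbol (r := r) (g := fun _ => 1) continuous_const a b c k
  simp only [one_mul, fourierCoeffMatrix_one] at h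
  refine h.trans ?_
  have e1 : k - 1 = 0 ↔ k = 1 := by omega
  have e2 : k + 1 = 0 ↔ k = -1 := by omega
  simp only [e1, e2]
  split_ifs <;> first | omega | simp

lemma exists_norm_fourierCoeffMatrix_le {g : ℝ → Matrix (Fin r) (Fin r) ℂ} (hg : Continuous g) :
    ∃ C : ℝ, 0 ≤ C ∧ ∀ k s t, ‖fourierCoeffMatrix g k s t‖ ≤ C := by
  have hst : ∀ s t, ∃ M : ℝ, ∀ θ ∈ Set.Icc (-Real.pi) Real.pi, ‖g θ s t‖ ≤ M := fun s t =>
    isCompact_Icc.exists_bound_of_continuousOn (hg.matrix_elem s t).continuousOn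
  choose M hM using hst
  have hπ : (0 : ℝ) < 2 * Real.pi := by positivity
  have hle : ∀ s t, M s t ≤ ∑ s, ∑ t, |M s t| := fun s t =>
    (le_abs_self _).trans ((Finset.single_le_sum (f := fun t => |M s t|)
      (fun _ _ => abs_nonneg _) (Finset.mem_univ t)).trans
      (Finset.single_le_sum (f := fun s => ∑ t, |M s t|)
        (fun _ _ => Finset.sum_nonneg fun _ _ => abs_nonneg _) (Finset.mem_univ s)))
  refine ⟨∑ s, ∑ t, |M s t|,
    Finset.sum_nonneg fun _ _ => Finset.sum_nonneg fun _ _ => abs_nonneg _, fun k s t => ?_⟩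
  have h := intervalIntegral.norm_integral_le_of_norm_le_const (a := -Real.pi) (b := Real.pi)
    (C := ∑ s, ∑ t, |M s t|)
    (f := fun θ => g θ s t * Complex.exp (-(Complex.I * (k : ℂ) * (θ : ℂ)))) (by
      intro θ hθ
      rw [Set.uIoc_of_le (by linarith [Real.pi_pos])] at hθ
      have : -(Complex.I * (k : ℂ) * (θ : ℂ)) = ((-(k * θ) : ℝ) : ℂ) * Complex.I := by
        push_cast; ring
      rw [norm_mul, this, Complex.norm_exp_ofReal_mul_I, mul_one]
      exact (hM s t θ (Set.Ioc_subset_Icc_self hθ)).trans (hle s t))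
  rw [fourierCoeffMatrix, Matrix.of_apply, norm_mul, norm_div, norm_one, norm_mul,
    Complex.norm_real, Real.norm_of_nonneg Real.pi_pos.le, Complex.norm_ofNat, one_div,
    inv_mul_le_iff₀ hπ]
  refine h.trans (le_of_eq ?_)
  rw [sub_neg_eq_add, ← two_mul, abs_of_pos hπ, mul_comm]

end FourierCoefficients

/-! ### Trace estimates independent of the matrix size -/

section TraceEstimates

/-- Only the rows of `B` indexed by `S` enter the trace, and each costs at most `C` times an
absolute row sum. -/
lemma norm_trace_mul_le_of_column_support {ι : Type} [Fintype ι] {E B : Matrix ι ι ℂ}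
    {S : Finset ι} {C K : ℝ} (hC : 0 ≤ C) (hE : ∀ p q, ‖E p q‖ ≤ C)
    (hS : ∀ p, ∀ q ∉ S, E p q = 0) (hB : RowSumLE B K) : ‖(E * B).trace‖ ≤ S.card * (C * K) := by
  have h : (E * B).trace = ∑ q ∈ S, ∑ p, E p q * B q p := by
    simp only [Matrix.trace, Matrix.diag_apply, Matrix.mul_apply]
    rw [Finset.sum_comm]
    refine (Finset.sum_subset (Finset.subset_univ S) fun q _ hq => ?_).symm
    simp [hS _ q hq]
  rw [h]
  refine (norm_sum_le_of_le _ fun q _ => ?_).trans (le_of_eq (by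
    rw [Finset.sum_const, nsmul_eq_mul]))
  calc ‖∑ p, E p q * B q p‖ ≤ ∑ p, C * ‖B q p‖ := norm_sum_le_of_le _ fun p _ => by
        rw [norm_mul]; gcongr; exact hE p q
    _ = C * ∑ p, ‖B q p‖ := by rw [Finset.mul_sum]
    _ ≤ C * K := by gcongr; exact hB q

/-- Compression to the indices other than `none` fails to be multiplicative only by a rank-one term
for each new factor. The test matrix `B` lets the induction absorb that factor: it replaces `B` by
`A * B` and `L` by `K * L`. -/
lemma norm_trace_pow_submatrix_some_sub_le {κ : Type} [Fintype κ] [DecidableEq κ]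
    {T : Matrix (Option κ) (Option κ) ℂ} {K : ℝ} (hT : RowSumLE T K) (hK : 0 ≤ K) (m : ℕ) :
    ∀ (B : Matrix κ κ ℂ) (L : ℝ), 0 ≤ L → RowSumLE B L →
      ‖(((T ^ m).submatrix some some - (T.submatrix some some) ^ m) * B).trace‖ ≤
        m * K ^ m * L := by
  induction m with
  | zero =>
    intro B L _ _
    have : (1 : Matrix (Option κ) (Option κ) ℂ).submatrix some some = 1 :=
      Matrix.submatrix_one _ (Option.some_injective κ)
    simp [this]
  | succ m ih =>
    intro B L hL hB
    set A := T.submatrix some some with hA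
    -- `R` collects the products whose last intermediate index is `none`.
    set R : Matrix κ κ ℂ := Matrix.of fun i j => (T ^ m) (some i) none * T none (some j) with hR
    have hsplit : (T ^ (m + 1)).submatrix some some - A ^ (m + 1) =
        ((T ^ m).submatrix some some - A ^ m) * A + R := by
      ext i j
      rw [sub_mul, ← pow_succ]
      simp only [Matrix.sub_apply, Matrix.add_apply, Matrix.submatrix_apply, pow_succ T,
        Matrix.mul_apply, Fintype.sum_option, hA, hR, Matrix.of_apply]
      ring
    have hR' : ‖(R * B).trace‖ ≤ K ^ (m + 1) * L := by
      simp only [Matrix.trace, Matrix.diag_apply, Matrix.mul_apply, hR, Matrix.of_apply]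
      rw [Finset.sum_comm]
      calc ‖∑ j, ∑ i, (T ^ m) (some i) none * T none (some j) * B j i‖
          ≤ ∑ j, ∑ i, K ^ m * (‖T none (some j)‖ * ‖B j i‖) := by
            refine norm_sum_le_of_le _ fun j _ => norm_sum_le_of_le _ fun i _ => ?_
            rw [norm_mul, norm_mul, mul_assoc]
            gcongr
            exact (hT.pow hK m).norm_le _ _
        _ = K ^ m * ∑ j, ‖T none (some j)‖ * ∑ i, ‖B j i‖ := by
            simp only [Finset.mul_sum]
        _ ≤ K ^ m * ∑ j, ‖T none (some j)‖ * L := by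
            gcongr with j
            exact hB j
        _ = K ^ m * ((∑ j, ‖T none (some j)‖) * L) := by rw [Finset.sum_mul]
        _ ≤ K ^ m * (K * L) := by
            gcongr
            have := hT none
            rw [Fintype.sum_option] at this
            linarith [norm_nonneg (T none none)]
        _ = K ^ (m + 1) * L := by ring
    have hAB : RowSumLE (A * B) (K * L) := (hT.submatrix (Option.some_injective κ)).mul hB hL
    rw [hsplit, add_mul, Matrix.trace_add, mul_assoc]
    refine (norm_add_le _ _).trans ((add_le_add (ih _ _ (by positivity) hAB) hR').trans
      (le_of_eq ?_))
    push_cast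
    ring

/-- Deleting one row and the corresponding column changes the trace of a power by an amount that
does not depend on the size. -/
lemma norm_trace_pow_sub_trace_pow_submatrix_le {ι κ : Type} [Fintype ι] [DecidableEq ι]
    [Fintype κ] [DecidableEq κ] {T : Matrix ι ι ℂ} {K : ℝ} (hT : RowSumLE T K) (hK : 0 ≤ K)
    (e : Option κ ≃ ι) (m : ℕ) :
    ‖(T ^ m).trace - ((T.submatrix (e ∘ some) (e ∘ some)) ^ m).trace‖ ≤ (m + 1) * K ^ m := by
  have hT' : RowSumLE (T.submatrix e e) K := hT.submatrix e.injective
  have hpow : (T.submatrix e e) ^ m = (T ^ m).submatrix e e := by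
    have := map_pow (Matrix.reindexAlgEquiv ℂ ℂ e.symm) T m
    simpa [Matrix.coe_reindexAlgEquiv, Matrix.reindex_apply] using this.symm
  have h1 := norm_trace_pow_submatrix_some_sub_le hT' hK m 1 1 zero_le_one RowSumLE.one
  rw [mul_one, mul_one, Matrix.trace_sub, hpow] at h1
  have h2 : (T ^ m).trace = (T ^ m) (e none) (e none) +
      (((T ^ m).submatrix e e).submatrix some some).trace := by
    rw [Matrix.trace, ← e.sum_comp, Fintype.sum_option]
    rfl
  -- The diagonal entry at the deleted index accounts for the `+ 1` in the constant.
  have h3 := (hT.pow hK m).norm_le (e none) (e none)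
  rw [h2, add_sub_assoc]
  refine (norm_add_le _ _).trans ((add_le_add h3 h1).trans (le_of_eq ?_))
  ring

end TraceEstimates

/-! ### Products and powers of block Toeplitz matrices -/

section ToeplitzTrace

variable {r : ℕ}

/-- With `d` an integer, the nonexistent block neighbours `-1` and `n` contribute zero; all boundary
effects of `T_n` arise this way. -/
lemma sum_fin_ite_shift {M : Type*} [AddCommMonoid M] {n : ℕ} (d : ℤ) (g : ℤ → M) :
    ∑ l : Fin n, (if (l.val : ℤ) = d then g l.val else 0) =
      if 0 ≤ d ∧ d < n then g d else 0 := by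
  split_ifs with h
  · obtain ⟨e, rfl⟩ := Int.eq_ofNat_of_zero_le h.1
    have he : e < n := by omega
    rw [Finset.sum_eq_single (⟨e, he⟩ : Fin n)]
    · simp
    · intro l _ hl
      rw [if_neg]
      intro h'
      exact hl (Fin.ext (by simpa using h'))
    · simp
  · refine Finset.sum_eq_zero fun l _ => if_neg ?_
    intro h'
    exact h ⟨by omega, by omega⟩

lemma toeplitz_apply_trigSymbol (n : ℕ) (a b c : Matrix (Fin r) (Fin r) ℂ)
    (p q : Fin n × Fin r) :
    toeplitz n (trigSymbol a b c) p q =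
      (if (p.1.val : ℤ) = q.1.val then a p.2 q.2 else 0) +
      (if (p.1.val : ℤ) = q.1.val + 1 then b p.2 q.2 else 0) +
      (if (p.1.val : ℤ) = q.1.val - 1 then c p.2 q.2 else 0) := by
  rw [toeplitz, Matrix.of_apply, fourierCoeffMatrix_trigSymbol]
  split_ifs <;> first | omega | simp

/-- The largest possible absolute row sum of `a + b e^{iθ} + c e^{-iθ}` is at most this number. -/
def trigBound (a b c : Matrix (Fin r) (Fin r) ℂ) : ℝ :=
  ∑ s, ∑ t, (‖a s t‖ + ‖b s t‖ + ‖c s t‖)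

lemma trigBound_nonneg (a b c : Matrix (Fin r) (Fin r) ℂ) : 0 ≤ trigBound a b c :=
  Finset.sum_nonneg fun _ _ => Finset.sum_nonneg fun _ _ => by positivity

lemma sum_row_le_trigBound (a b c : Matrix (Fin r) (Fin r) ℂ) (s : Fin r) :
    ∑ t, (‖a s t‖ + ‖b s t‖ + ‖c s t‖) ≤ trigBound a b c :=
  Finset.single_le_sum (f := fun s => ∑ t, (‖a s t‖ + ‖b s t‖ + ‖c s t‖))
    (fun _ _ => Finset.sum_nonneg fun _ _ => by positivity) (Finset.mem_univ s)

lemma rowSumLE_trigSymbol (a b c : Matrix (Fin r) (Fin r) ℂ) (θ : ℝ) :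
    RowSumLE (trigSymbol a b c θ) (trigBound a b c) := by
  intro s
  refine (Finset.sum_le_sum fun t _ => ?_).trans (sum_row_le_trigBound a b c s)
  have h1 : ‖Complex.exp (Complex.I * (θ : ℂ))‖ = 1 := by
    rw [mul_comm, Complex.norm_exp_ofReal_mul_I]
  have h2 : ‖Complex.exp (-(Complex.I * (θ : ℂ)))‖ = 1 := by
    have : -(Complex.I * (θ : ℂ)) = ((-θ : ℝ) : ℂ) * Complex.I := by push_cast; ring
    rw [this, Complex.norm_exp_ofReal_mul_I]
  simp only [trigSymbol, Matrix.add_apply, Matrix.smul_apply, smul_eq_mul]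
  refine norm_add₃_le.trans (le_of_eq ?_)
  rw [norm_mul, norm_mul, h1, h2, one_mul, one_mul]

/-- A block row contains each of `a`, `b`, `c` at most once, hence a bound independent of `n`. -/
lemma rowSumLE_toeplitz_trigSymbol (n : ℕ) (a b c : Matrix (Fin r) (Fin r) ℂ) :
    RowSumLE (toeplitz n (trigSymbol a b c)) (trigBound a b c) := by
  rintro ⟨k, s⟩
  refine le_trans ?_ (sum_row_le_trigBound a b c s)
  rw [Fintype.sum_prod_type_right]
  refine Finset.sum_le_sum fun t _ => ?_
  have key : ∀ l : Fin n, ‖toeplitz n (trigSymbol a b c) (k, s) (l, t)‖ ≤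
      (if (l.val : ℤ) = (k.val : ℤ) then ‖a s t‖ else 0) +
      (if (l.val : ℤ) = (k.val : ℤ) - 1 then ‖b s t‖ else 0) +
      (if (l.val : ℤ) = (k.val : ℤ) + 1 then ‖c s t‖ else 0) := by
    intro l
    rw [toeplitz_apply_trigSymbol]
    refine norm_add₃_le.trans (le_of_eq ?_)
    dsimp only
    have e0 : (k.val : ℤ) = l.val ↔ (l.val : ℤ) = k.val := by omega
    have e1 : (k.val : ℤ) = l.val + 1 ↔ (l.val : ℤ) = k.val - 1 := by omega
    have e2 : (k.val : ℤ) = l.val - 1 ↔ (l.val : ℤ) = k.val + 1 := by omega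
    simp only [e0, e1, e2, apply_ite norm, norm_zero]
  refine (Finset.sum_le_sum fun l _ => key l).trans ?_
  rw [Finset.sum_add_distrib, Finset.sum_add_distrib,
    sum_fin_ite_shift _ (fun _ => ‖a s t‖), sum_fin_ite_shift _ (fun _ => ‖b s t‖),
    sum_fin_ite_shift _ (fun _ => ‖c s t‖)]
  gcongr <;> split_ifs <;> first | exact le_rfl | exact norm_nonneg _

/-- Toeplitz matrices are multiplicative up to the first and the last block column, if the second
symbol is a trigonometric polynomial of degree one. -/
lemma toeplitz_mul_toeplitz_trigSymbol_apply (n : ℕ) {g : ℝ → Matrix (Fin r) (Fin r) ℂ}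
    (a b c : Matrix (Fin r) (Fin r) ℂ) (p q : Fin n × Fin r) :
    (toeplitz n g * toeplitz n (trigSymbol a b c)) p q =
      (fourierCoeffMatrix g ((p.1.val : ℤ) - q.1.val) * a) p.2 q.2 +
      (if (q.1.val : ℤ) + 1 < n then
        (fourierCoeffMatrix g ((p.1.val : ℤ) - q.1.val - 1) * b) p.2 q.2 else 0) +
      (if 0 < q.1.val then
        (fourierCoeffMatrix g ((p.1.val : ℤ) - q.1.val + 1) * c) p.2 q.2 else 0) := by
  obtain ⟨i, s⟩ := p
  obtain ⟨j, t⟩ := q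
  have hi := i.isLt
  have hj := j.isLt
  rw [Matrix.mul_apply, Fintype.sum_prod_type]
  have key : ∀ l : Fin n,
      ∑ u, toeplitz n g (i, s) (l, u) * toeplitz n (trigSymbol a b c) (l, u) (j, t) =
      (if (l.val : ℤ) = j.val then
        (fun z : ℤ => (fourierCoeffMatrix g ((i.val : ℤ) - z) * a) s t) l.val else 0) +
      (if (l.val : ℤ) = j.val + 1 then
        (fun z : ℤ => (fourierCoeffMatrix g ((i.val : ℤ) - z) * b) s t) l.val else 0) +
      (if (l.val : ℤ) = j.val - 1 then
        (fun z : ℤ => (fourierCoeffMatrix g ((i.val : ℤ) - z) * c) s t) l.val else 0) := by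
    intro l
    simp only [toeplitz_apply_trigSymbol, mul_add, mul_ite, mul_zero, Finset.sum_add_distrib,
      Matrix.mul_apply]
    simp only [toeplitz, Matrix.of_apply]
    split_ifs <;> simp
  simp only [key, Finset.sum_add_distrib]
  refine congrArg₂ _ (congrArg₂ _ ((sum_fin_ite_shift _ fun z : ℤ =>
    (fourierCoeffMatrix g ((i.val : ℤ) - z) * a) s t).trans ?_) ((sum_fin_ite_shift _ fun z : ℤ =>
    (fourierCoeffMatrix g ((i.val : ℤ) - z) * b) s t).trans ?_)) ((sum_fin_ite_shift _ fun z : ℤ =>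
    (fourierCoeffMatrix g ((i.val : ℤ) - z) * c) s t).trans ?_)
  · rw [if_pos (by omega)]
  · refine if_congr (by omega) ?_ rfl
    rw [sub_add_eq_sub_sub]
  · refine if_congr (by omega) ?_ rfl
    rw [sub_sub_eq_add_sub, add_sub_right_comm]

/-- The defect of multiplicativity occupies at most `2 r` scalar columns, with entries bounded
uniformly in `n`. -/
lemma norm_trace_toeplitz_mul_sub_le {g : ℝ → Matrix (Fin r) (Fin r) ℂ} (hg : Continuous g)
    (a b c : Matrix (Fin r) (Fin r) ℂ) :
    ∃ C : ℝ, 0 ≤ C ∧ ∀ n : ℕ, 1 ≤ n → ∀ (B : Matrix (Fin n × Fin r) (Fin n × Fin r) ℂ) (L : ℝ),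
      0 ≤ L → RowSumLE B L →
      ‖((toeplitz n g * toeplitz n (trigSymbol a b c) -
        toeplitz n (fun θ => g θ * trigSymbol a b c θ)) * B).trace‖ ≤ C * L := by
  have hbound : ∀ d : Matrix (Fin r) (Fin r) ℂ, ∃ C : ℝ, 0 ≤ C ∧
      ∀ k s t, ‖(fourierCoeffMatrix g k * d) s t‖ ≤ C := by
    intro d
    -- `trigSymbol d 0 0` is the constant `d`, so the products in question are Fourier coefficients
    -- of the continuous function `g d`.
    obtain ⟨C, hC, h⟩ := exists_norm_fourierCoeffMatrix_le
      (g := fun θ => g θ * trigSymbol d 0 0 θ) (hg.mul (continuous_trigSymbol d 0 0))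
    refine ⟨C, hC, fun k s t => ?_⟩
    have := h k s t
    simpa [fourierCoeffMatrix_mul_trigSymbol hg] using this
  obtain ⟨Cb, hCb, hb⟩ := hbound b
  obtain ⟨Cc, hCc, hc⟩ := hbound c
  refine ⟨2 * r * (Cb + Cc), by positivity, fun n hn B L hL hB => ?_⟩
  set S : Finset (Fin n × Fin r) :=
    ({⟨0, by omega⟩, ⟨n - 1, by omega⟩} : Finset (Fin n)) ×ˢ Finset.univ with hS
  -- Only an inequality: for `n = 1` the first and last block columns coincide.
  have hcard : (S.card : ℝ) ≤ 2 * r := by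
    rw [hS, Finset.card_product, Finset.card_univ, Fintype.card_fin]
    have : ({⟨0, by omega⟩, ⟨n - 1, by omega⟩} : Finset (Fin n)).card ≤ 2 := Finset.card_le_two
    push_cast
    gcongr
    exact_mod_cast this
  have hE : ∀ p q, (toeplitz n g * toeplitz n (trigSymbol a b c) -
      toeplitz n (fun θ => g θ * trigSymbol a b c θ)) p q =
      -(if (q.1.val : ℤ) + 1 < n then 0 else
        (fourierCoeffMatrix g ((p.1.val : ℤ) - q.1.val - 1) * b) p.2 q.2) +
      -(if 0 < q.1.val then 0 else
        (fourierCoeffMatrix g ((p.1.val : ℤ) - q.1.val + 1) * c) p.2 q.2) := by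
    intro p q
    rw [Matrix.sub_apply, toeplitz_mul_toeplitz_trigSymbol_apply, toeplitz, Matrix.of_apply,
      fourierCoeffMatrix_mul_trigSymbol hg, Matrix.add_apply, Matrix.add_apply]
    split_ifs <;> ring
  refine (norm_trace_mul_le_of_column_support (S := S) (C := Cb + Cc) (by positivity) ?_ ?_
    hB).trans ?_
  · intro p q
    rw [hE]
    refine (norm_add_le _ _).trans (add_le_add ?_ ?_)
    · rw [norm_neg]
      split_ifs
      · simpa using hCb
      · exact hb _ _ _
    · rw [norm_neg]
      split_ifs
      · simpa using hCc
      · exact hc _ _ _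
  · intro p q hq
    have hq' := q.1.isLt
    simp only [hS, Finset.mem_product, Finset.mem_insert, Finset.mem_singleton, Finset.mem_univ,
      and_true, not_or, Fin.ext_iff] at hq
    rw [hE, if_pos (by omega), if_pos (by omega)]
    simp
  · rw [mul_assoc (2 * (r : ℝ))]
    gcongr

/-- The error at `m + 1` is the error at `m` times `T_n(f)`, plus one defect of multiplicativity.
The extra factor is absorbed into `B`, which multiplies `L` by the row sum bound, so the constant
never depends on `n`. -/
lemma norm_trace_toeplitz_pow_mul_sub_le (a b c : Matrix (Fin r) (Fin r) ℂ) (m : ℕ) :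
    ∃ C : ℝ, 0 ≤ C ∧ ∀ n : ℕ, 1 ≤ n → ∀ (B : Matrix (Fin n × Fin r) (Fin n × Fin r) ℂ) (L : ℝ),
      0 ≤ L → RowSumLE B L →
      ‖((toeplitz n (trigSymbol a b c) ^ m -
        toeplitz n (fun θ => trigSymbol a b c θ ^ m)) * B).trace‖ ≤ C * L := by
  induction m with
  | zero =>
    refine ⟨0, le_rfl, fun n hn B L hL hB => ?_⟩
    have : toeplitz n (fun _ => (1 : Matrix (Fin r) (Fin r) ℂ)) = 1 := by
      ext p q
      rw [toeplitz, Matrix.of_apply, fourierCoeffMatrix_one, Matrix.one_apply]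
      by_cases h : p.1 = q.1
      · simp [h, Matrix.one_apply, Prod.ext_iff]
      · have : (p.1.val : ℤ) - q.1.val ≠ 0 := by
          intro h'
          exact h (Fin.ext (by omega))
        simp [h, this, Prod.ext_iff]
    simp [this]
  | succ m ih =>
    obtain ⟨C, hC, h⟩ := ih
    obtain ⟨C', hC', h'⟩ := norm_trace_toeplitz_mul_sub_le
      ((continuous_trigSymbol a b c).pow m) a b c
    refine ⟨C * trigBound a b c + C', add_nonneg (mul_nonneg hC (trigBound_nonneg a b c)) hC',
      fun n hn B L hL hB => ?_⟩
    have hTB := (rowSumLE_toeplitz_trigSymbol n a b c).mul hB hL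
    have h1 := h n hn _ _ (mul_nonneg (trigBound_nonneg a b c) hL) hTB
    have h2 := h' n hn B L hL hB
    simp only [Pi.pow_apply, ← pow_succ] at h2
    have hsplit : (toeplitz n (trigSymbol a b c) ^ (m + 1) -
        toeplitz n (fun θ => trigSymbol a b c θ ^ (m + 1))) * B =
        (toeplitz n (trigSymbol a b c) ^ m - toeplitz n (fun θ => trigSymbol a b c θ ^ m)) *
          (toeplitz n (trigSymbol a b c) * B) +
        (toeplitz n (fun θ => trigSymbol a b c θ ^ m) * toeplitz n (trigSymbol a b c) -
          toeplitz n (fun θ => trigSymbol a b c θ ^ (m + 1))) * B := by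
      rw [pow_succ (toeplitz n (trigSymbol a b c))]
      noncomm_ring
    rw [hsplit, Matrix.trace_add]
    refine (norm_add_le _ _).trans ((add_le_add h1 h2).trans (le_of_eq ?_))
    ring

lemma trace_toeplitz (n : ℕ) {g : ℝ → Matrix (Fin r) (Fin r) ℂ} (hg : Continuous g) :
    (toeplitz n g).trace =
      n * ((1 / (2 * (Real.pi : ℂ))) * ∫ θ in (-Real.pi)..Real.pi, (g θ).trace) := by
  simp only [Matrix.trace, Matrix.diag_apply, toeplitz, Matrix.of_apply, Fintype.sum_prod_type,
    sub_self, fourierCoeffMatrix, Int.cast_zero, mul_zero, zero_mul, neg_zero, Complex.exp_zero,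
    mul_one, Finset.sum_const, Finset.card_univ, Fintype.card_fin, nsmul_eq_mul]
  rw [intervalIntegral.integral_finsetSum
    fun s _ => (hg.matrix_elem s s).intervalIntegrable _ _, Finset.mul_sum, Finset.mul_sum, Finset.mul_sum]

/-- The traces of the powers of `T_n(f)` are asymptotically those of the powers of the symbol. -/
lemma exists_norm_trace_toeplitz_pow_sub_le (a b c : Matrix (Fin r) (Fin r) ℂ) (m : ℕ) :
    ∃ C : ℝ, ∀ n : ℕ, 1 ≤ n → ‖(toeplitz n (trigSymbol a b c) ^ m).trace -
      n * ((1 / (2 * (Real.pi : ℂ))) *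
        ∫ θ in (-Real.pi)..Real.pi, (trigSymbol a b c θ ^ m).trace)‖ ≤ C := by
  obtain ⟨C, -, h⟩ := norm_trace_toeplitz_pow_mul_sub_le a b c m
  refine ⟨C, fun n hn => ?_⟩
  have := h n hn 1 1 zero_le_one RowSumLE.one
  rwa [mul_one, mul_one, Matrix.trace_sub,
    trace_toeplitz n (g := fun θ => trigSymbol a b c θ ^ m)
      ((continuous_trigSymbol a b c).pow m)] at this

end ToeplitzTrace

/-! ### Assembly of the stiffness matrix from elements -/

section Assembly

variable {r : ℕ}

/-- The polynomial on the reference element by which the global shape function of index `m` is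
represented on the element `k`. -/
def elementShape (ξ : Fin (r + 1) → ℝ) (m : ℕ) (k : ℤ) : Polynomial ℝ :=
  ∑ i : Fin (r + 1), if ltg r i k = (m : ℤ) then localShape ξ i else 0

/-- Inside an open element the floor is constantly `k`, so the global shape function agrees near `x`
with a polynomial in an affine variable. -/
lemma hasDerivAt_globalShape {a b : ℝ} {n : ℕ} {h : ℝ} (hh : (b - a) / n = h) (hpos : 0 < h)
    (ξ : Fin (r + 1) → ℝ) (m : ℕ) (k : ℕ) {x : ℝ} (hx1 : a + k * h < x)
    (hx2 : x < a + (k + 1) * h) :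
    HasDerivAt (globalShape a b n ξ m)
      ((elementShape ξ m k).derivative.eval ((x - a) / h - k) * (1 / h)) x := by
  have h1 : HasDerivAt (fun y => (elementShape ξ m k).eval ((y - a) / h - k))
      ((elementShape ξ m k).derivative.eval ((x - a) / h - k) * (1 / h)) x := by
    have h2 : HasDerivAt (fun y : ℝ => (y - a) / h - k) (1 / h) x :=
      (((hasDerivAt_id x).sub_const a).div_const h).sub_const _
    exact ((elementShape ξ m k).hasDerivAt _).comp x h2
  refine h1.congr_of_eventuallyEq ?_
  filter_upwards [Ioo_mem_nhds hx1 hx2] with y hy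
  have hfl : ⌊(y - a) / h⌋ = (k : ℤ) := by
    rw [Int.floor_eq_iff]
    constructor
    · rw [le_div_iff₀ hpos]
      push_cast
      linarith [hy.1]
    · rw [div_lt_iff₀ hpos]
      push_cast
      linarith [hy.2]
  have hfr : Int.fract ((y - a) / h) = (y - a) / h - k := by
    rw [← Int.self_sub_floor, hfl]
    push_cast
    rfl
  simp only [globalShape, elementShape, hh, hfl, hfr, Polynomial.eval_finsetSum]
  refine Finset.sum_congr rfl fun i _ => ?_
  split_ifs <;> simp

lemma integral_derivative_elementShape (ξ : Fin (r + 1) → ℝ) (p q : ℕ) (k : ℤ) :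
    ∫ x in (0 : ℝ)..1, (elementShape ξ p k).derivative.eval x *
      (elementShape ξ q k).derivative.eval x =
    ∑ i, ∑ j, if ltg r i k = (p : ℤ) ∧ ltg r j k = (q : ℤ) then Aloc ξ i j else 0 := by
  have key : ∀ x : ℝ, (elementShape ξ p k).derivative.eval x *
      (elementShape ξ q k).derivative.eval x =
      ∑ i, ∑ j, (if ltg r i k = (p : ℤ) ∧ ltg r j k = (q : ℤ) then (1 : ℝ) else 0) *
        ((localShape ξ i).derivative.eval x * (localShape ξ j).derivative.eval x) := by
    intro x
    simp only [elementShape, Polynomial.derivative_sum, Polynomial.eval_finsetSum]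
    rw [Finset.sum_mul_sum]
    refine Finset.sum_congr rfl fun i _ => Finset.sum_congr rfl fun j _ => ?_
    by_cases h1 : ltg r i k = (p : ℤ) <;> by_cases h2 : ltg r j k = (q : ℤ) <;> simp [h1, h2]
  have hc : ∀ (z : ℝ) i j, Continuous fun x : ℝ =>
      z * ((localShape ξ i).derivative.eval x * (localShape ξ j).derivative.eval x) := by
    intro z i j
    fun_prop
  simp only [key]
  rw [intervalIntegral.integral_finsetSum fun i _ =>
    (continuous_finsetSum _ fun j _ => hc _ i j).intervalIntegrable _ _]
  refine Finset.sum_congr rfl fun i _ => ?_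
  rw [intervalIntegral.integral_finsetSum fun j _ => (hc _ i j).intervalIntegrable _ _]
  refine Finset.sum_congr rfl fun j _ => ?_
  rw [intervalIntegral.integral_const_mul]
  split_ifs <;> simp [Aloc]

/-- The stiffness matrix is assembled from the local matrices of the elements. -/
lemma stiffness_one_apply {a b : ℝ} (hab : a < b) {n : ℕ} (hn : 1 ≤ n) (ξ : Fin (r + 1) → ℝ)
    (p q : Fin (n * r - 1)) :
    stiffness (fun _ => 1) a b n ξ p q = ∑ k ∈ Finset.range n, ∑ i, ∑ j,
      if ltg r i (k : ℤ) = ((p.val + 1 : ℕ) : ℤ) ∧ ltg r j (k : ℤ) = ((q.val + 1 : ℕ) : ℤ)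
        then Aloc ξ i j else 0 := by
  have hn0 : (0 : ℝ) < n := by exact_mod_cast hn
  obtain ⟨h, hh⟩ : ∃ h, (b - a) / n = h := ⟨_, rfl⟩
  have hpos : 0 < h := hh ▸ div_pos (sub_pos.mpr hab) hn0
  have hb : a + n * h = b := by rw [← hh]; field_simp; ring
  set F : ℝ → ℝ := fun x => 1 * deriv (globalShape a b n ξ (p.val + 1)) x *
    deriv (globalShape a b n ξ (q.val + 1)) x with hF
  set P : ℕ → ℝ → ℝ := fun k y => (elementShape ξ (p.val + 1) k).derivative.eval y *
    (elementShape ξ (q.val + 1) k).derivative.eval y with hP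
  have hPc : ∀ k, Continuous (P k) := fun k => by simp only [hP]; fun_prop
  have hlt : ∀ k : ℕ, a + k * h ≤ a + ((k + 1 : ℕ) : ℝ) * h := by
    intro k; push_cast; nlinarith
  -- The chain rule gives `1 / h` twice; the substitution in the integral gives back one `h`, and
  -- the normalization of the stiffness matrix cancels the other. Equality on the open element
  -- suffices, the mesh nodes being a null set.
  have hEq : ∀ k : ℕ, Set.EqOn (fun x => (1 / h ^ 2) * P k ((x - a) / h - k)) F
      (Set.Ioo (a + k * h) (a + ((k + 1 : ℕ) : ℝ) * h)) := by
    intro k x hx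
    have hx2 := hx.2
    push_cast at hx2
    simp only [hF, hP, (hasDerivAt_globalShape hh hpos ξ _ k hx.1 hx2).deriv]
    field_simp
  have hint : ∀ k < n, IntervalIntegrable F volume ((fun k : ℕ => a + k * h) k)
      ((fun k : ℕ => a + k * h) (k + 1)) := by
    intro k _
    have hc : Continuous fun x => (1 / h ^ 2) * P k ((x - a) / h - k) := by
      have := hPc k
      fun_prop
    refine (hc.intervalIntegrable _ _).congr_uIoo ?_
    exact (Set.uIoo_of_le (hlt k)).symm ▸ hEq k
  have hel : ∀ k : ℕ, ∫ x in (a + k * h)..(a + ((k + 1 : ℕ) : ℝ) * h), F x =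
      h⁻¹ * ∫ y in (0 : ℝ)..1, P k y := by
    intro k
    rw [← intervalIntegral.integral_congr_uIoo
      (f := fun x => (1 / h ^ 2) * P k ((x - a) / h - k)) (by
        rw [Set.uIoo_of_le (hlt k)]; exact hEq k), intervalIntegral.integral_const_mul]
    have : ∀ x : ℝ, (x - a) / h - k = x / h - (a / h + k) := fun x => by ring
    simp only [this]
    rw [intervalIntegral.integral_comp_div_sub (P k) hpos.ne']
    have e1 : (a + k * h) / h - (a / h + k) = 0 := by field_simp; ring
    have e2 : (a + ((k + 1 : ℕ) : ℝ) * h) / h - (a / h + k) = 1 := by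
      push_cast; field_simp; ring
    rw [e1, e2, smul_eq_mul]
    field_simp
  have hsum := intervalIntegral.sum_integral_adjacent_intervals hint
  simp only [Nat.cast_zero, zero_mul, add_zero, hb] at hsum
  rw [stiffness, Matrix.smul_apply, galerkinMatrix, Matrix.of_apply, hh, ← hsum, smul_eq_mul,
    Finset.mul_sum]
  refine Finset.sum_congr rfl fun k _ => ?_
  rw [hel, ← mul_assoc, mul_inv_cancel₀ hpos.ne', one_mul, ← integral_derivative_elementShape]

end Assembly

/-! ### The stiffness matrix as a submatrix of the Toeplitz matrix -/

section StiffnessToeplitz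

variable {r : ℕ}

lemma symbol_eq_trigSymbol (ξ : Fin (r + 1) → ℝ) :
    symbol ξ = trigSymbol ((alphaXi ξ).map Complex.ofReal) ((betaXi ξ).map Complex.ofReal)
      ((betaXi ξ)ᵀ.map Complex.ofReal) := rfl

lemma mul_add_eq_mul_add_iff {k l : ℕ} {i j : ℕ} (hi : i < r) (hj : j < r) :
    k * r + i = l * r + j ↔ k = l ∧ i = j := by
  refine ⟨fun h => ?_, by rintro ⟨rfl, rfl⟩; rfl⟩
  have hr : 0 < r := by omega
  have h1 := congrArg (· / r) h
  have h2 := congrArg (· % r) h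
  simp only [Nat.mul_comm _ r, Nat.mul_add_div hr, Nat.mul_add_mod,
    Nat.mod_eq_of_lt hi, Nat.mod_eq_of_lt hj, Nat.div_eq_of_lt hi, Nat.div_eq_of_lt hj,
    add_zero] at h1 h2
  exact ⟨h1, h2⟩

lemma ltg_castSucc_eq_iff (i j : Fin r) (k l : ℕ) :
    ltg r i.castSucc (k : ℤ) = ((l * r + j.val : ℕ) : ℤ) ↔ k = l ∧ i = j := by
  rw [Fin.ext_iff, ← mul_add_eq_mul_add_iff i.isLt j.isLt, ltg, Fin.val_castSucc]
  norm_cast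

/-- The last node of element `k` is the first node of element `k + 1`. -/
lemma ltg_last_eq_iff (j : Fin r) (k l : ℕ) :
    ltg r (Fin.last r) (k : ℤ) = ((l * r + j.val : ℕ) : ℤ) ↔ k + 1 = l ∧ j.val = 0 := by
  have hr : 0 < r := j.pos
  rw [eq_comm (b := 0), ← mul_add_eq_mul_add_iff hr j.isLt, ltg, Fin.val_last, add_mul, one_mul,
    add_zero]
  norm_cast

lemma sum_range_ite_eq {n k₀ : ℕ} {c : ℕ → Prop} [DecidablePred c] (hc : ∀ k, c k → k = k₀)
    (hk : c k₀ → k₀ < n) (z : ℝ) :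
    ∑ k ∈ Finset.range n, (if c k then z else 0) = if c k₀ then z else 0 := by
  by_cases h : c k₀
  · rw [Finset.sum_eq_single_of_mem k₀ (Finset.mem_range.mpr (hk h))]
    intro k _ hne
    exact if_neg fun h' => hne (hc k h')
  · rw [if_neg h]
    refine Finset.sum_eq_zero fun k _ => if_neg fun h' => h ?_
    rwa [← hc k h']

/-- A node `k r + s` with `0 < s < r` belongs to element `k` alone; one with `s = 0` is also the
last node of element `k - 1`. Splitting according to which of the two local indices is last gives
the terms on the right. The assumption `hks` excludes node `0`, which has no element to its left. -/
lemma sum_local_eq {n : ℕ} (A : Matrix (Fin (r + 1)) (Fin (r + 1)) ℝ) {k l : ℕ} (hk : k < n)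
    (hl : l < n) (s t : Fin r) (hks : 1 ≤ k * r + s.val) :
    (∑ e ∈ Finset.range n, ∑ i, ∑ j,
      if ltg r i (e : ℤ) = ((k * r + s.val : ℕ) : ℤ) ∧ ltg r j (e : ℤ) = ((l * r + t.val : ℕ) : ℤ)
        then A i j else 0) =
      (if k = l then A s.castSucc t.castSucc +
        (if s.val = 0 ∧ t.val = 0 then A (Fin.last r) (Fin.last r) else 0) else 0) +
      (if k = l + 1 ∧ s.val = 0 then A (Fin.last r) t.castSucc else 0) +
      (if k + 1 = l ∧ t.val = 0 then A s.castSucc (Fin.last r) else 0) := by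
  have key : ∀ e : ℕ, (∑ i, ∑ j,
      if ltg r i (e : ℤ) = ((k * r + s.val : ℕ) : ℤ) ∧ ltg r j (e : ℤ) = ((l * r + t.val : ℕ) : ℤ)
        then A i j else 0) =
      (if e = k ∧ e = l then A s.castSucc t.castSucc else 0) +
      (if e = k ∧ e + 1 = l ∧ t.val = 0 then A s.castSucc (Fin.last r) else 0) +
      (if e + 1 = k ∧ s.val = 0 ∧ e = l then A (Fin.last r) t.castSucc else 0) +
      (if e + 1 = k ∧ s.val = 0 ∧ e + 1 = l ∧ t.val = 0 then
        A (Fin.last r) (Fin.last r) else 0) := by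
    intro e
    simp only [Fin.sum_univ_castSucc, ltg_castSucc_eq_iff, ltg_last_eq_iff]
    rw [Finset.sum_add_distrib]
    have h1 : (∑ i : Fin r, ∑ j : Fin r, if (e = k ∧ i = s) ∧ e = l ∧ j = t then
        A i.castSucc j.castSucc else 0) =
        if e = k ∧ e = l then A s.castSucc t.castSucc else 0 := by
      rw [Finset.sum_eq_single s (fun i _ hi => Finset.sum_eq_zero fun j _ => if_neg
        fun h => hi h.1.2) (by simp), Finset.sum_eq_single t (fun j _ hj => if_neg
        fun h => hj h.2.2) (by simp)]
      simp
    have h2 : (∑ i : Fin r, if (e = k ∧ i = s) ∧ e + 1 = l ∧ t.val = 0 then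
        A i.castSucc (Fin.last r) else 0) =
        if e = k ∧ e + 1 = l ∧ t.val = 0 then A s.castSucc (Fin.last r) else 0 := by
      rw [Finset.sum_eq_single s (fun i _ hi => if_neg fun h => hi h.1.2) (by simp)]
      simp
    have h3 : (∑ j : Fin r, if (e + 1 = k ∧ s.val = 0) ∧ e = l ∧ j = t then
        A (Fin.last r) j.castSucc else 0) =
        if e + 1 = k ∧ s.val = 0 ∧ e = l then A (Fin.last r) t.castSucc else 0 := by
      rw [Finset.sum_eq_single t (fun j _ hj => if_neg fun h => hj h.2.2) (by simp)]
      simp [and_assoc]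
    rw [h1, h2, h3]
    simp only [and_assoc, add_assoc]
  simp only [key, Finset.sum_add_distrib]
  rw [sum_range_ite_eq (k₀ := k) (by tauto) (by tauto),
    sum_range_ite_eq (k₀ := k) (by tauto) (by tauto),
    sum_range_ite_eq (k₀ := l) (by tauto) (by tauto),
    sum_range_ite_eq (k₀ := k - 1) (by omega) (by omega)]
  -- This makes the truncated subtraction `k - 1` genuine in the term where both local indices are
  -- last.
  have hk0 : s.val = 0 → 1 ≤ k := by
    intro h0
    by_contra hk0
    have : k = 0 := by omega
    subst this
    omega
  have e4 : (k - 1 + 1 = k ∧ s.val = 0 ∧ k - 1 + 1 = l ∧ t.val = 0) ↔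
      (k = l ∧ s.val = 0 ∧ t.val = 0) := by omega
  have e3 : l + 1 = k ↔ k = l + 1 := eq_comm
  simp only [e4, e3, true_and, and_true]
  by_cases hkl : k = l
  · simp [hkl]
  · simp [hkl]
    ring

lemma alphaXi_apply (ξ : Fin (r + 1) → ℝ) (s t : Fin r) :
    alphaXi ξ s t = Aloc ξ s.castSucc t.castSucc +
      if s.val = 0 ∧ t.val = 0 then Aloc ξ (Fin.last r) (Fin.last r) else 0 := by
  have hr : 0 < r := s.pos
  have h0 : ∀ u : Fin r, u.castSucc = (0 : Fin (r + 1)) ↔ u.val = 0 := fun u => by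
    simp [Fin.ext_iff]
  have h1 : ∀ u : Fin r, u.castSucc ≠ Fin.last r := fun u => Fin.castSucc_ne_last u
  simp only [alphaXi, Axi, Matrix.submatrix_apply, Matrix.of_apply, h0, h1, and_self, or_false]
  split_ifs with h
  · rw [(h0 s).mpr h.1, (h0 t).mpr h.2]
  · rw [add_zero]

lemma betaXi_apply (ξ : Fin (r + 1) → ℝ) (s t : Fin r) :
    betaXi ξ s t = if s.val = 0 then Aloc ξ (Fin.last r) t.castSucc else 0 := by
  have hr : 0 < r := s.pos
  have h2 : Fin.last r ≠ 0 := by simp [Fin.ext_iff]; omega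
  simp [betaXi, Axi, h2]

lemma interiorIndex_injective (n r : ℕ) : Function.Injective (interiorIndex n r) := by
  intro p q h
  have := finProdFinEquiv.symm.injective h
  rw [Fin.mk.injEq] at this
  exact Fin.ext (by omega)

lemma interiorIndex_val (n r : ℕ) (m : Fin (n * r - 1)) :
    m.val + 1 = (interiorIndex n r m).1.val * r + (interiorIndex n r m).2.val := by
  have h : finProdFinEquiv (interiorIndex n r m) = ⟨m.val + 1, by omega⟩ :=
    finProdFinEquiv.apply_symm_apply _
  have h' := congrArg Fin.val h
  rw [finProdFinEquiv_apply_val] at h'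
  linarith

/-- The stiffness matrix is the Toeplitz matrix of the symbol without the first row and column. -/
theorem stiffnessSeq_eq_submatrix {a b : ℝ} (hab : a < b) {n : ℕ} (hn : 1 ≤ n)
    (ξ : Fin (r + 1) → ℝ) :
    stiffnessSeq a b ξ n =
      (toeplitzSeq ξ n).submatrix (interiorIndex n r) (interiorIndex n r) := by
  ext p q
  rw [stiffnessSeq, Matrix.map_apply, stiffness_one_apply hab hn, Matrix.submatrix_apply,
    toeplitzSeq, symbol_eq_trigSymbol, toeplitz_apply_trigSymbol]
  simp only [interiorIndex_val]
  rw [sum_local_eq _ (interiorIndex n r p).1.isLt (interiorIndex n r q).1.isLt _ _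
    (by rw [← interiorIndex_val]; omega)]
  generalize interiorIndex n r p = P
  generalize interiorIndex n r q = Q
  have e1 : (P.1.val : ℤ) = Q.1.val ↔ P.1.val = Q.1.val := by omega
  have e2 : (P.1.val : ℤ) = Q.1.val + 1 ↔ P.1.val = Q.1.val + 1 := by omega
  have e3 : (P.1.val : ℤ) = Q.1.val - 1 ↔ P.1.val + 1 = Q.1.val := by omega
  simp only [e1, e2, e3, Matrix.map_apply, Matrix.transpose_apply, alphaXi_apply, betaXi_apply,
    Aloc_symm ξ (Fin.last r) P.2.castSucc, ite_and]
  simp only [Complex.ofReal_add, apply_ite Complex.ofReal, Complex.ofReal_zero]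

end StiffnessToeplitz

/-! ### Distributions and clusters of the two sequences -/

section Distribution

variable {r : ℕ}

lemma toeplitz_trigSymbol_isHermitian (n : ℕ) {a b : Matrix (Fin r) (Fin r) ℂ}
    (ha : a.IsHermitian) : (toeplitz n (trigSymbol a b bᴴ)).IsHermitian := by
  ext p q
  have h1 : (q.1.val : ℤ) = p.1.val ↔ (p.1.val : ℤ) = q.1.val := eq_comm
  have h2 : (q.1.val : ℤ) = p.1.val + 1 ↔ (p.1.val : ℤ) = q.1.val - 1 := by omega
  have h3 : (q.1.val : ℤ) = p.1.val - 1 ↔ (p.1.val : ℤ) = q.1.val + 1 := by omega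
  simp only [Matrix.conjTranspose_apply, toeplitz_apply_trigSymbol, star_add, apply_ite star,
    star_zero, star_star, ha.apply, h1, h2, h3]
  ring

lemma toeplitzSeq_isHermitian (ξ : Fin (r + 1) → ℝ) (n : ℕ) : (toeplitzSeq ξ n).IsHermitian := by
  have ha : ((alphaXi ξ).map Complex.ofReal).IsHermitian := by
    ext i j
    simp [alphaXi, Axi_symm ξ j.castSucc i.castSucc]
  have hb : (betaXi ξ)ᵀ.map Complex.ofReal = ((betaXi ξ).map Complex.ofReal)ᴴ := by
    ext i j
    simp
  rw [toeplitzSeq, symbol_eq_trigSymbol, hb]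
  exact toeplitz_trigSymbol_isHermitian n ha

lemma continuous_symbol (ξ : Fin (r + 1) → ℝ) : Continuous (symbol ξ) :=
  continuous_trigSymbol _ _ _

/-- A common bound for the absolute row sums of the symbol and of its Toeplitz matrices. -/
def symbolBound (ξ : Fin (r + 1) → ℝ) : ℝ :=
  trigBound ((alphaXi ξ).map Complex.ofReal) ((betaXi ξ).map Complex.ofReal)
    ((betaXi ξ)ᵀ.map Complex.ofReal)

lemma symbolBound_nonneg (ξ : Fin (r + 1) → ℝ) : 0 ≤ symbolBound ξ := trigBound_nonneg _ _ _

lemma rowSumLE_symbol (ξ : Fin (r + 1) → ℝ) (θ : ℝ) : RowSumLE (symbol ξ θ) (symbolBound ξ) :=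
  rowSumLE_trigSymbol _ _ _ θ

lemma rowSumLE_toeplitzSeq (ξ : Fin (r + 1) → ℝ) (n : ℕ) :
    RowSumLE (toeplitzSeq ξ n) (symbolBound ξ) :=
  rowSumLE_toeplitz_trigSymbol n _ _ _

/-- Allowing `d n` to differ from `n r` by at most `1` serves both sizes, `n r` and `n r - 1`. The
distance to the limit is at most `(C + ‖I / r‖) / d n`. -/
lemma tendsto_div_of_norm_sub_le {u : ℕ → ℂ} {d : ℕ → ℕ} {I : ℂ} {C : ℝ} (hr : 1 ≤ r)
    (hu : ∀ n : ℕ, 1 ≤ n → ‖u n - n * I‖ ≤ C) (hd : ∀ n : ℕ, 1 ≤ n → ‖(n : ℂ) * r - d n‖ ≤ 1)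
    (hlim : Filter.Tendsto d Filter.atTop Filter.atTop) :
    Filter.Tendsto (fun n => (1 / (d n : ℂ)) * u n) Filter.atTop (𝓝 (I / r)) := by
  have hr0 : (r : ℂ) ≠ 0 := by
    have : r ≠ 0 := by omega
    exact_mod_cast this
  rw [tendsto_iff_norm_sub_tendsto_zero]
  have hlim' : Filter.Tendsto (fun n => (C + ‖I / r‖) / (d n : ℝ)) Filter.atTop (𝓝 0) :=
    Filter.Tendsto.const_div_atTop (tendsto_natCast_atTop_atTop.comp hlim) _
  refine squeeze_zero' (Filter.Eventually.of_forall fun n => norm_nonneg _) ?_ hlim'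
  filter_upwards [hlim.eventually_ge_atTop 1, Filter.eventually_ge_atTop 1] with n hdn hn
  have hd0 : (d n : ℂ) ≠ 0 := by
    have : d n ≠ 0 := by omega
    exact_mod_cast this
  have hsplit : (1 / (d n : ℂ)) * u n - I / r =
      ((u n - n * I) + ((n : ℂ) * r - d n) * (I / r)) / (d n : ℂ) := by
    field_simp
    ring
  rw [hsplit, norm_div, Complex.norm_natCast]
  gcongr
  refine (norm_add_le _ _).trans (add_le_add (hu n hn) ?_)
  rw [norm_mul]
  exact mul_le_of_le_one_left (norm_nonneg _) (hd n hn)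

lemma moment_symbol_eq (ξ : Fin (r + 1) → ℝ) (m : ℕ) :
    (1 / ((volume.real (Set.Icc (-Real.pi) Real.pi) : ℝ) : ℂ)) *
        ∫ θ in Set.Icc (-Real.pi) Real.pi, (symbol ξ θ ^ m).trace / (r : ℂ) =
      ((1 / (2 * (Real.pi : ℂ))) * ∫ θ in (-Real.pi)..Real.pi, (symbol ξ θ ^ m).trace) / r := by
  have hle : -Real.pi ≤ Real.pi := by linarith [Real.pi_pos]
  rw [MeasureTheory.integral_div, intervalIntegral.integral_of_le hle,
    MeasureTheory.integral_Icc_eq_integral_Ioc, Real.volume_real_Icc_of_le hle, mul_div_assoc]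
  push_cast
  ring

lemma tendsto_card_toeplitz (hr : 1 ≤ r) :
    Filter.Tendsto (fun n => Fintype.card (Fin n × Fin r)) Filter.atTop Filter.atTop := by
  refine Filter.tendsto_atTop_mono (fun n => ?_) Filter.tendsto_id
  simp only [id, Fintype.card_prod, Fintype.card_fin]
  exact Nat.le_mul_of_pos_right n hr

lemma tendsto_card_stiffness (hr : 1 ≤ r) :
    Filter.Tendsto (fun n => Fintype.card (Fin (n * r - 1))) Filter.atTop Filter.atTop := by
  refine Filter.tendsto_atTop_mono (fun n => ?_) (Filter.tendsto_sub_atTop_nat 1)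
  rw [Fintype.card_fin]
  exact Nat.sub_le_sub_right (Nat.le_mul_of_pos_right n hr) 1

theorem eigenvalueDistribution_toeplitzSeq (hr : 1 ≤ r) (ξ : Fin (r + 1) → ℝ) :
    EigenvalueDistribution (toeplitzSeq ξ) (Set.Icc (-Real.pi) Real.pi) (symbol ξ) := by
  refine eigenvalueDistribution_of_moments hr (continuous_symbol ξ) (symbol_isHermitian ξ)
    (rowSumLE_symbol ξ) (toeplitzSeq_isHermitian ξ) (rowSumLE_toeplitzSeq ξ)
    (tendsto_card_toeplitz hr) fun m => ?_
  rw [moment_symbol_eq]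
  obtain ⟨C, hC⟩ := exists_norm_trace_toeplitz_pow_sub_le ((alphaXi ξ).map Complex.ofReal)
    ((betaXi ξ).map Complex.ofReal) ((betaXi ξ)ᵀ.map Complex.ofReal) m
  exact tendsto_div_of_norm_sub_le hr hC (fun n _ => by simp) (tendsto_card_toeplitz hr)

/-- Here `none` stands for the very first index of `T_n(f)`, the one that is deleted. -/
lemma exists_option_equiv (hr : 1 ≤ r) {n : ℕ} (hn : 1 ≤ n) :
    ∃ e : Option (Fin (n * r - 1)) ≃ Fin n × Fin r, e ∘ some = interiorIndex n r := by
  have h : n * r - 1 + 1 = n * r := Nat.sub_add_cancel (Nat.mul_pos hn hr)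
  refine ⟨((finSuccEquiv (n * r - 1)).symm.trans (finCongr h)).trans finProdFinEquiv.symm, ?_⟩
  funext m
  simp only [Function.comp_apply, Equiv.trans_apply, finSuccEquiv_symm_some, interiorIndex]
  rfl

variable {a b : ℝ}

lemma stiffnessSeq_isHermitian (hab : a < b) (ξ : Fin (r + 1) → ℝ) (n : ℕ) :
    (stiffnessSeq a b ξ n).IsHermitian := by
  -- For `n = 0` truncated subtraction gives size `0 * r - 1 = 0`, and the matrix is empty.
  rcases Nat.eq_zero_or_pos n with rfl | hn
  · ext i
    exact absurd i.isLt (by simp)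
  · rw [stiffnessSeq_eq_submatrix hab hn]
    exact (toeplitzSeq_isHermitian ξ n).submatrix _

lemma rowSumLE_stiffnessSeq (hab : a < b) (ξ : Fin (r + 1) → ℝ) (n : ℕ) :
    RowSumLE (stiffnessSeq a b ξ n) (symbolBound ξ) := by
  rcases Nat.eq_zero_or_pos n with rfl | hn
  · intro i
    exact absurd i.isLt (by simp)
  · rw [stiffnessSeq_eq_submatrix hab hn]
    exact (rowSumLE_toeplitzSeq ξ n).submatrix (interiorIndex_injective n r)

theorem eigenvalueDistribution_stiffnessSeq (hab : a < b) (hr : 1 ≤ r) (ξ : Fin (r + 1) → ℝ) :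
    EigenvalueDistribution (stiffnessSeq a b ξ) (Set.Icc (-Real.pi) Real.pi) (symbol ξ) := by
  refine eigenvalueDistribution_of_moments hr (continuous_symbol ξ) (symbol_isHermitian ξ)
    (rowSumLE_symbol ξ) (stiffnessSeq_isHermitian hab ξ) (rowSumLE_stiffnessSeq hab ξ)
    (tendsto_card_stiffness hr) fun m => ?_
  rw [moment_symbol_eq]
  obtain ⟨C, hC⟩ := exists_norm_trace_toeplitz_pow_sub_le ((alphaXi ξ).map Complex.ofReal)
    ((betaXi ξ).map Complex.ofReal) ((betaXi ξ)ᵀ.map Complex.ofReal) m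
  -- The constant adds the cost of the deleted row and column to the Toeplitz trace error.
  refine tendsto_div_of_norm_sub_le (C := (m + 1) * symbolBound ξ ^ m + C) hr (fun n hn => ?_)
    (fun n hn => ?_) (tendsto_card_stiffness hr)
  · obtain ⟨e, he⟩ := exists_option_equiv hr hn
    have h := norm_trace_pow_sub_trace_pow_submatrix_le (rowSumLE_toeplitzSeq ξ n)
      (symbolBound_nonneg ξ) e m
    rw [he, ← stiffnessSeq_eq_submatrix hab hn, norm_sub_rev] at h
    rw [← sub_add_sub_cancel _ ((toeplitzSeq ξ n ^ m).trace)]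
    exact (norm_add_le _ _).trans (add_le_add h (hC n hn))
  · have h : 1 ≤ n * r := Nat.mul_pos hn hr
    rw [Fintype.card_fin, Nat.cast_sub h]
    simp

lemma mem_eigRange_iff (ξ : Fin (r + 1) → ℝ) (z : ℂ) :
    z ∈ eigRange ξ ↔ ∃ θ ∈ Set.Icc (-Real.pi) Real.pi, z ∈ eigs (symbol ξ θ) := by
  simp only [eigRange, Set.mem_iUnion, Set.mem_image, eigFun, eigs,
    (symbol_isHermitian ξ _).roots_charpoly_eq_eigenvalues₀, Multiset.mem_map, Finset.mem_val,
    Finset.mem_univ, true_and, Function.comp_apply]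
  constructor
  · rintro ⟨j, θ, hθ, rfl⟩
    exact ⟨θ, hθ, _, rfl⟩
  · rintro ⟨θ, hθ, i, rfl⟩
    -- `eigFun` reverses the nonincreasing order of `eigenvalues₀`, so the reversed index is the
    -- witness.
    refine ⟨(Fin.cast (Fintype.card_fin r) i).rev, θ, hθ, ?_⟩
    rw [Fin.rev_rev]
    rfl

/-- The set is the projection to `ℂ` of the closed set `det (z - f(θ)) = 0` in `[-π, π] × ℂ`, and
projection along a compact factor is a closed map. -/
lemma isClosed_eigRange (ξ : Fin (r + 1) → ℝ) : IsClosed (eigRange ξ) := by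
  have h : eigRange ξ = Prod.snd '' {p : Set.Icc (-Real.pi) Real.pi × ℂ |
      (Matrix.scalar (Fin r) p.2 - symbol ξ p.1).det = 0} := by
    ext z
    simp only [mem_eigRange_iff, eigs, Set.mem_image, Set.mem_ofPred_eq, Prod.exists,
      Polynomial.mem_roots (Matrix.charpoly_monic _).ne_zero, Polynomial.IsRoot.def,
      Matrix.eval_charpoly, Subtype.exists]
    constructor
    · rintro ⟨θ, hθ, hz⟩
      exact ⟨θ, hθ, z, hz, rfl⟩
    · rintro ⟨θ, hθ, w, hw, rfl⟩
      exact ⟨θ, hθ, hw⟩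
  rw [h]
  refine isClosedMap_snd_of_compactSpace _ (isClosed_eq ?_ continuous_const)
  have h1 : Continuous fun p : Set.Icc (-Real.pi) Real.pi × ℂ => symbol ξ p.1 :=
    (continuous_symbol ξ).comp (continuous_subtype_val.comp continuous_fst)
  have h2 : Continuous fun p : Set.Icc (-Real.pi) Real.pi × ℂ => Matrix.scalar (Fin r) p.2 := by
    simp only [Matrix.scalar_apply]
    fun_prop
  exact (h2.sub h1).matrix_det

lemma eigRange_nonempty (hr : 1 ≤ r) (ξ : Fin (r + 1) → ℝ) : (eigRange ξ).Nonempty :=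
  ⟨_, Set.mem_iUnion.mpr ⟨⟨0, hr⟩, 0, ⟨by linarith [Real.pi_pos], Real.pi_pos.le⟩, rfl⟩⟩

end Distribution

end WeightsFEM

end

theorem mainTheorem4 (a b : ℝ) (hab : a < b) (r : ℕ) (hr : 1 ≤ r)
    (ξ : Fin (r + 1) → ℝ) (hξ : Function.Injective ξ)
    (hξmem : ∀ i, ξ i ∈ Set.Icc (0 : ℝ) 1) (hξ0 : ξ 0 = 0) (hξ1 : ξ (Fin.last r) = 1) :
    (∀ n : ℕ, 1 ≤ n →
      Function.Injective (interiorIndex n r) ∧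
      stiffnessSeq a b ξ n =
        (toeplitzSeq ξ n).submatrix (interiorIndex n r) (interiorIndex n r)) ∧
    SingularValueDistribution (toeplitzSeq ξ) (Set.Icc (-Real.pi) Real.pi) (symbol ξ) ∧
    EigenvalueDistribution (toeplitzSeq ξ) (Set.Icc (-Real.pi) Real.pi) (symbol ξ) ∧
    SingularValueDistribution (stiffnessSeq a b ξ) (Set.Icc (-Real.pi) Real.pi) (symbol ξ) ∧
    EigenvalueDistribution (stiffnessSeq a b ξ) (Set.Icc (-Real.pi) Real.pi) (symbol ξ) ∧
    WeaklyClustered (toeplitzSeq ξ) (eigRange ξ) ∧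
    WeaklyClustered (stiffnessSeq a b ξ) (eigRange ξ) := by
  have hT := eigenvalueDistribution_toeplitzSeq hr ξ
  have hA := eigenvalueDistribution_stiffnessSeq hab hr ξ
  have hS : ∀ θ ∈ Set.Icc (-Real.pi) Real.pi, ∀ z ∈ eigs (symbol ξ θ), z ∈ eigRange ξ :=
    fun θ hθ z hz => (mem_eigRange_iff ξ z).mpr ⟨θ, hθ, hz⟩
  exact ⟨fun n hn => ⟨interiorIndex_injective n r, stiffnessSeq_eq_submatrix hab hn ξ⟩,
    hT.singularValueDistribution (symbol_isHermitian ξ) (toeplitzSeq_isHermitian ξ), hT,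
    hA.singularValueDistribution (symbol_isHermitian ξ) (stiffnessSeq_isHermitian hab ξ), hA,
    hT.weaklyClustered (rowSumLE_toeplitzSeq ξ) (isClosed_eigRange ξ) (eigRange_nonempty hr ξ) hS,
    hA.weaklyClustered (rowSumLE_stiffnessSeq hab ξ) (isClosed_eigRange ξ)
      (eigRange_nonempty hr ξ) hS⟩
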